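/- Let $\kappa\in(0,1)$ and let $F(a,b;c;x)$ denote the Gauss hypergeometric function ${}_2F_1$. Let $\phi:\mathbb R\to\mathbb R$ be the inverse of the strictly increasing bijection $T\mapsto\int_0^T F(\tfrac14,\tfrac34;\tfrac12;\kappa^2\sin^2 t)\,dt$ of $\mathbb R$, put $\psi=\arcsin(\kappa\sin\phi)$ and $\rho_\kappa=\cos\psi:\mathbb R\to\mathbb R$. Then $\rho_\kappa$ extends to a unique elliptic function on $\mathbb C$, Shen's signature-four function $\mathrm{dn}_2=\rho_\kappa$, and there is a unique Weierstrass function $p_\kappa=\wp(\bullet;g_2,g_3)$ with invariants $g_2=\tfrac43-\kappa^2$ and $g_3=\tfrac8{27}-\tfrac13\kappa^2$. Each of the functions $\mathrm{dn}_2$ and $p_\kappa$ has exactly one fundamental pair of periods $(2\omega_\kappa,2\omega_\kappa')$ (that is, its periods are precisely the integer linear combinations of $2\omega_\kappa$ and $2\omega_\kappa'$) for which $\omega_\kappa$ and $-i\omega_\kappa'$ are strictly positive real numbers; for both functions it is given by $$\omega_\kappa=\tfrac12\pi\,F(\tfrac14,\tfrac34;1;\kappa^2),\qquad \omega_\kappa'=i\,\tfrac{\sqrt2}{2}\,\pi\,F(\tfrac14,\tfrac34;1;1-\kappa^2).$$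 Thus the period ratio is $$\frac{\omega_\kappa'}{\omega_\kappa}=i\sqrt2\,\frac{F(\tfrac14,\tfrac34;1;1-\kappa^2)}{F(\tfrac14,\tfrac34;1;\kappa^2)}.$$ -/

import Mathlib

open Set

noncomputable section

namespace SignatureFour

/-- The incomplete hypergeometric integral
`T ↦ ∫₀ᵀ F(1/4, 3/4; 1/2; κ² sin² t) dt` on the real line. -/
def incompleteIntegral (κ : ℝ) (T : ℝ) : ℝ :=
  ∫ t in (0 : ℝ)..T,
    ordinaryHypergeometric (1 / 4 : ℝ) (3 / 4 : ℝ) (1 / 2 : ℝ) (κ ^ 2 * Real.sin t ^ 2)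

/-- The amplitude `φ : ℝ → ℝ`: the inverse function of the incomplete integral (for `0 < κ < 1`
the latter is an increasing bijection of `ℝ`). -/
def phi (κ : ℝ) : ℝ → ℝ :=
  Function.invFun (incompleteIntegral κ)

/-- `ψ = arcsin (κ sin φ)`. -/
def psi (κ : ℝ) (u : ℝ) : ℝ :=
  Real.arcsin (κ * Real.sin (phi κ u))

/-- `ρ = cos ψ`, a function on the real line. -/
def rho (κ : ℝ) (u : ℝ) : ℝ :=
  Real.cos (psi κ u)

/-- An elliptic function: a meromorphic function on `ℂ` that is periodic with respect to a
lattice of rank two. As functions here have values at all points, we ask for the normal form: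
removable singularities are removed and the value at every pole is `0`. -/
structure IsElliptic (f : ℂ → ℂ) : Prop where
  meromorphicNF : MeromorphicNFOn f univ
  doublyPeriodic : ∃ L : PeriodPair, ∀ l ∈ L.lattice, Function.Periodic f l

/-- `d` is the function `dn₂` of modulus `κ`: the elliptic function that extends `ρ`. -/
structure IsDnTwo (κ : ℝ) (d : ℂ → ℂ) : Prop where
  elliptic : IsElliptic d
  extends_rho : ∀ u : ℝ, d (u : ℂ) = (rho κ u : ℂ)

/-- `p` is the Weierstrass function `℘(•; g₂, g₃)` with invariants `g₂` and `g₃`. -/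
def IsWeierstrassP (g₂ g₃ : ℂ) (p : ℂ → ℂ) : Prop :=
  ∃ L : PeriodPair, L.g₂ = g₂ ∧ L.g₃ = g₃ ∧ p = L.weierstrassP

/-- `p` is the function `p_κ = ℘(•; 4/3 - κ², 8/27 - κ²/3)`. -/
def IsPKappa (κ : ℝ) (p : ℂ → ℂ) : Prop :=
  IsWeierstrassP (4 / 3 - (κ : ℂ) ^ 2) (8 / 27 - (κ : ℂ) ^ 2 / 3) p

/-- `(2ω, 2ω')` is a fundamental pair of periods of `f` for which `ω` and `-iω'` are strictly
positive real numbers: the periods of `f` are exactly the integer combinations of `2ω`, `2ω'`. -/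
structure AreFundamentalHalfPeriods (f : ℂ → ℂ) (ω ω' : ℂ) : Prop where
  real_pos : ω.im = 0 ∧ 0 < ω.re
  imag_pos : (-Complex.I * ω').im = 0 ∧ 0 < (-Complex.I * ω').re
  periods : ∀ w : ℂ, Function.Periodic f w ↔
    ∃ m n : ℤ, w = (m : ℂ) * (2 * ω) + (n : ℂ) * (2 * ω')

/-- The complete hypergeometric function `F(1/4, 3/4; 1; x)`. -/
def completeF (x : ℝ) : ℝ :=
  ordinaryHypergeometric (1 / 4 : ℝ) (3 / 4 : ℝ) (1 : ℝ) x

end SignatureFour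

end

/-! ### Hypergeometric series: an elementary closed form and the complete integrals. -/

noncomputable section
namespace SignatureFour

open Real

/-! Put `l = √(1 - κ²)`. Since `F(1/4, 3/4; 1/2; s²)` is the even part of `(1 - s)^(-1/2)`, the
integrand defining `φ` is elementary, and `ρ` satisfies `ρ'² = 2(1 - ρ)(ρ² - l²)`. The substitution
`ρ = 1/3 - 2P` turns this into the Weierstrass equation with `g₂ = 1/3 + l² = 4/3 - κ²` and `g₃ =
-1/27 + l²/3 = 8/27 - κ²/3`. In the imaginary direction the sign of the right side flips, and `τ'² =
2(1 - τ)(l² - τ²)` is solved by `τ = l cos θ`, where `θ'² = 2(1 - l cos θ)`. Termwise integration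
gives the periods: `W = π F(1/4, 3/4; 1; κ²)` for `ρ` and `V = √2 π F(1/4, 3/4; 1; l²)` for `τ`.

It remains to know that a Weierstrass function with these invariants has exactly the lattice spanned
by `W` and `iV`. Start from this lattice, let `℘` be its Weierstrass function, and write down what
`℘(x + iy)` must be. With `σ` the translate of `ρ` by `W/2` and `c` the half period `(W + iV)/2`,
one expects `℘(x + c) = 1/6 - σ(x)/2` and `℘(iy + c) = 1/6 - τ(y)/2`; as `2c` is a period, the
addition theorem expresses `℘(x + iy)` through `σ`, `τ` and their derivatives. This expression is
`addition`. It satisfies the Cauchy-Riemann equations off the lattice (`differentiableAt_addition`),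
is doubly periodic, and has principal part `1/z²` at `0` (`exists_analyticAt_sub_weierstrassP`), so
by Liouville it is `℘` plus a constant. Comparing the differential equations near the pole kills the
constant and identifies `g₂` and `g₃` (`weierstrassP_eq_addition`).

On the line `Im z = V/2` the formula reads `ρ(u) = 1/3 - 2 ℘(u + iV/2)`, which continues `ρ` to the
plane (`isDnTwo_shiftedP`). Uniqueness is the identity theorem for `dn₂` and a power series argument
for `℘` (`weierstrassP_eq_of_invariants`). The poles show that both functions have no periods
outside the lattice, and a rectangular lattice has only one positive pair of generators on the axes.
-/

/-- The binomial series of `(1 - x) ^ (-1/2)`. -/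
lemma hasSum_inv_sqrt_one_sub {x : ℝ} (hx : |x| < 1) :
    HasSum (fun n : ℕ ↦ ((ascPochhammer ℝ n).eval (1 / 2) / n.factorial) * x ^ n)
      (1 / √(1 - x)) := by
  have h := (Real.one_div_one_sub_rpow_hasFPowerSeriesOnBall_zero (1 / 2)).hasSum
    (y := x) (by simpa [enorm_eq_nnnorm, ← NNReal.coe_lt_coe] using hx)
  simp only [zero_add, FormalMultilinearSeries.ofScalars_apply_eq, smul_eq_mul] at h
  rw [Real.sqrt_eq_rpow]
  have e (n : ℕ) : Ring.choose (1 / 2 + (n : ℝ) - 1) n =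
      (ascPochhammer ℝ n).eval (1 / 2) / n.factorial := by
    have := Ring.factorial_nsmul_multichoose_eq_ascPochhammer (1 / 2 : ℝ) n
    rw [nsmul_eq_mul, Polynomial.ascPochhammer_smeval_eq_eval, Ring.multichoose_eq] at this
    rw [eq_div_iff (by positivity), ← this]
    ring
  simpa only [e] using h

/-- Duplication: `(1/2)_{2n} = 4ⁿ (1/4)_n (3/4)_n` and `(2n)! = 4ⁿ n! (1/2)_n`. -/
lemma ordinaryHypergeometricCoefficient_quarter (n : ℕ) :
    ordinaryHypergeometricCoefficient (1 / 4 : ℝ) (3 / 4) (1 / 2) n =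
      (ascPochhammer ℝ (2 * n)).eval (1 / 2) / (2 * n).factorial := by
  induction n with
  | zero => simp [ordinaryHypergeometricCoefficient]
  | succ n ih =>
    have hp : (ascPochhammer ℝ n).eval (1 / 2 : ℝ) ≠ 0 :=
      (ascPochhammer_pos n _ (by norm_num)).ne'
    have e : ordinaryHypergeometricCoefficient (1 / 4 : ℝ) (3 / 4) (1 / 2) (n + 1) =
        ordinaryHypergeometricCoefficient (1 / 4 : ℝ) (3 / 4) (1 / 2) n *
          ((1 / 4 + n) * (3 / 4 + n) / ((1 / 2 + n) * (n + 1))) := by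
      simp only [ordinaryHypergeometricCoefficient, ascPochhammer_succ_eval, Nat.factorial_succ]
      push_cast
      field_simp
    rw [e, ih, show 2 * (n + 1) = 2 * n + 1 + 1 by ring, ascPochhammer_succ_eval,
      ascPochhammer_succ_eval, Nat.factorial_succ, Nat.factorial_succ]
    push_cast
    field_simp
    ring

/-- `F(1/4, 3/4; 1/2; s²)` is the even part of `(1 - s) ^ (-1/2)`. -/
lemma ordinaryHypergeometric_quarter_sq_hasSum {s : ℝ} (hs : |s| < 1) :
    HasSum (fun n : ℕ ↦ ordinaryHypergeometricCoefficient (1 / 4 : ℝ) (3 / 4) (1 / 2) n *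
      (s ^ 2) ^ n) ((1 / √(1 - s) + 1 / √(1 + s)) / 2) := by
  have h1 := hasSum_inv_sqrt_one_sub hs
  have h2 := hasSum_inv_sqrt_one_sub (x := -s) (by simpa using hs)
  rw [sub_neg_eq_add] at h2
  have h := (h1.add h2).div_const 2
  have hi : Function.Injective (fun n : ℕ ↦ 2 * n) := fun a b h ↦ by simpa using h
  rw [← hi.hasSum_iff] at h
  · refine (congrArg (HasSum · _) (funext fun n ↦ ?_)).mpr h
    rw [Function.comp_apply]
    rw [ordinaryHypergeometricCoefficient_quarter, pow_mul, pow_mul, neg_sq]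
    ring
  · intro n hn
    have : Odd n := by
      rw [← Nat.not_even_iff_odd]
      rintro ⟨k, rfl⟩
      exact hn ⟨k, two_mul k⟩
    rw [this.neg_pow]
    ring

lemma ordinaryHypergeometric_quarter_sq {s : ℝ} (hs : |s| < 1) :
    ordinaryHypergeometric (1 / 4 : ℝ) (3 / 4 : ℝ) (1 / 2 : ℝ) (s ^ 2) =
      (1 / √(1 - s) + 1 / √(1 + s)) / 2 := by
  rw [ordinaryHypergeometric_eq_tsum]
  simpa [smul_eq_mul] using (ordinaryHypergeometric_quarter_sq_hasSum hs).tsum_eq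

lemma ordinaryHypergeometricCoefficient_quarter_half_pos (n : ℕ) :
    0 < ordinaryHypergeometricCoefficient (1 / 4 : ℝ) (3 / 4) (1 / 2) n := by
  have h1 := ascPochhammer_pos n (1 / 4 : ℝ) (by norm_num)
  have h2 := ascPochhammer_pos n (3 / 4 : ℝ) (by norm_num)
  have h3 := ascPochhammer_pos n (1 / 2 : ℝ) (by norm_num)
  unfold ordinaryHypergeometricCoefficient
  positivity

/-- Wallis: the integral is `π (1/2)_n / n!`, which trades the lower parameter `1/2` for `1`. -/
lemma ordinaryHypergeometricCoefficient_quarter_one (n : ℕ) :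
    ordinaryHypergeometricCoefficient (1 / 4 : ℝ) (3 / 4) (1 / 2) n *
      ∫ t in (0 : ℝ)..π, sin t ^ (2 * n) =
      π * ordinaryHypergeometricCoefficient (1 / 4 : ℝ) (3 / 4) 1 n := by
  have h3 : ∀ n, (ascPochhammer ℝ n).eval (1 / 2) ≠ 0 := fun n ↦
    (ascPochhammer_pos n (1 / 2 : ℝ) (by norm_num)).ne'
  have h4 : ∀ n : ℕ, ∏ i ∈ Finset.range n, ((2 * (i : ℝ) + 1) / (2 * i + 2)) =
      (ascPochhammer ℝ n).eval (1 / 2) / n.factorial := by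
    intro n
    induction n with
    | zero => simp
    | succ n ih =>
      rw [Finset.prod_range_succ, ih, ascPochhammer_succ_eval, Nat.factorial_succ]
      push_cast
      field_simp
      ring
  rw [integral_sin_pow_even, h4, ordinaryHypergeometricCoefficient,
    ordinaryHypergeometricCoefficient, ascPochhammer_eval_one]
  have := h3 n
  field_simp

lemma continuous_inv_sqrt_one_sub_mul {k : ℝ} (hk : |k| < 1) {g : ℝ → ℝ} (hg : Continuous g)
    (hg1 : ∀ t, |g t| ≤ 1) :
    Continuous (fun t ↦ 1 / √(1 - k * g t)) := by
  refine continuous_const.div (by fun_prop) fun t ↦ ?_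
  have : |k * g t| < 1 := by
    rw [abs_mul]; exact (mul_le_of_le_one_right (abs_nonneg _) (hg1 t)).trans_lt hk
  have := (abs_lt.1 this).2
  exact (Real.sqrt_pos.2 (by linarith)).ne'

lemma abs_mul_lt_one {k x : ℝ} (hk : |k| < 1) (hx : |x| ≤ 1) : |k * x| < 1 := by
  rw [abs_mul]; exact (mul_le_of_le_one_right (abs_nonneg _) hx).trans_lt hk

/-- Termwise integration over a full period of `sin²`. -/
lemma integral_quarter {k : ℝ} (hk : |k| < 1) :
    ∫ t in (0 : ℝ)..π, ((1 / √(1 - k * sin t) + 1 / √(1 + k * sin t)) / 2) =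
      π * completeF (k ^ 2) := by
  have key : HasSum (fun n : ℕ ↦ ∫ t in (0 : ℝ)..π,
      ordinaryHypergeometricCoefficient (1 / 4 : ℝ) (3 / 4) (1 / 2) n * ((k * sin t) ^ 2) ^ n)
      (∫ t in (0 : ℝ)..π, ((1 / √(1 - k * sin t) + 1 / √(1 + k * sin t)) / 2)) := by
    -- The dominating series is the one at `sin t = 1`; it converges because `|k| < 1`.
    refine intervalIntegral.hasSum_integral_of_dominated_convergence
      (fun n _ ↦ ordinaryHypergeometricCoefficient (1 / 4 : ℝ) (3 / 4) (1 / 2) n * (k ^ 2) ^ n)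
      (fun n ↦ ?_) (fun n ↦ ?_) ?_ ?_ ?_
    · exact Continuous.aestronglyMeasurable (by fun_prop)
    · refine .of_forall fun t _ ↦ ?_
      have hc := ordinaryHypergeometricCoefficient_quarter_half_pos n
      rw [norm_mul, Real.norm_of_nonneg hc.le, Real.norm_of_nonneg (by positivity)]
      refine mul_le_mul_of_nonneg_left (pow_le_pow_left₀ (sq_nonneg _) ?_ n) hc.le
      rw [mul_pow]
      exact mul_le_of_le_one_right (sq_nonneg k) (sin_sq_le_one t)
    · exact .of_forall fun t _ ↦ (ordinaryHypergeometric_quarter_sq_hasSum hk).summable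
    · simp
    · exact .of_forall fun t _ ↦
        ordinaryHypergeometric_quarter_sq_hasSum (abs_mul_lt_one hk (abs_sin_le_one t))
  rw [← key.tsum_eq, completeF, ordinaryHypergeometric_eq_tsum, ← tsum_mul_left]
  refine tsum_congr fun n ↦ ?_
  have : ∀ t, ordinaryHypergeometricCoefficient (1 / 4 : ℝ) (3 / 4) (1 / 2) n *
      ((k * sin t) ^ 2) ^ n = (k ^ 2) ^ n * (ordinaryHypergeometricCoefficient (1 / 4 : ℝ)
        (3 / 4) (1 / 2) n * sin t ^ (2 * n)) := fun t ↦ by rw [pow_mul, mul_pow, mul_pow]; ring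
  simp_rw [this]
  rw [intervalIntegral.integral_const_mul, intervalIntegral.integral_const_mul,
    ordinaryHypergeometricCoefficient_quarter_one, smul_eq_mul]
  ring

/-- By symmetry about `π/2`, the terms with `1 - k sin t` and `1 + k sin t` are twice the
contributions of `[0, π/2]` and `[π/2, π]` to the cosine integral. This form is the one the pendulum
needs. -/
lemma integral_inv_sqrt_one_sub_cos {k : ℝ} (hk : |k| < 1) :
    ∫ t in (0 : ℝ)..π, 1 / √(1 - k * cos t) = π * completeF (k ^ 2) := by
  have hc1 : Continuous fun t ↦ 1 / √(1 - k * sin t) :=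
    continuous_inv_sqrt_one_sub_mul hk continuous_sin abs_sin_le_one
  have hc2 : Continuous fun t ↦ 1 / √(1 + k * sin t) := by
    simpa using continuous_inv_sqrt_one_sub_mul (k := -k) (by simpa using hk) continuous_sin
      abs_sin_le_one
  have hc3 : Continuous fun t ↦ 1 / √(1 - k * cos t) :=
    continuous_inv_sqrt_one_sub_mul hk continuous_cos abs_cos_le_one
  rw [← integral_quarter hk, intervalIntegral.integral_div, intervalIntegral.integral_add
    (hc1.intervalIntegrable _ _) (hc2.intervalIntegrable _ _)]
  have e1 : ∫ t in (0 : ℝ)..π, 1 / √(1 - k * sin t) =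
      2 * ∫ t in (0 : ℝ)..(π / 2), 1 / √(1 - k * cos t) := by
    rw [← intervalIntegral.integral_add_adjacent_intervals (b := π / 2)
      (hc1.intervalIntegrable _ _) (hc1.intervalIntegrable _ _)]
    have a1 := intervalIntegral.integral_comp_sub_left (a := 0) (b := π / 2)
      (fun t ↦ 1 / √(1 - k * sin t)) (π / 2)
    have a2 := intervalIntegral.integral_comp_add_left (a := 0) (b := π / 2)
      (fun t ↦ 1 / √(1 - k * sin t)) (π / 2)
    simp only [sin_pi_div_two_sub, add_comm (π / 2), sin_add_pi_div_two, sub_self, sub_zero,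
      zero_add, add_halves] at a1 a2
    rw [← a1, ← a2]
    ring
  have e2 : ∫ t in (0 : ℝ)..π, 1 / √(1 + k * sin t) =
      2 * ∫ t in (π / 2 : ℝ)..π, 1 / √(1 - k * cos t) := by
    rw [← intervalIntegral.integral_add_adjacent_intervals (b := π / 2)
      (hc2.intervalIntegrable _ _) (hc2.intervalIntegrable _ _)]
    have a1 := intervalIntegral.integral_comp_sub_left (a := π / 2) (b := π)
      (fun t ↦ 1 / √(1 + k * sin t)) (π + π / 2)
    have a2 := intervalIntegral.integral_comp_sub_right (a := π / 2) (b := π)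
      (fun t ↦ 1 / √(1 + k * sin t)) (π / 2)
    have s1 : ∀ t, sin (π + π / 2 - t) = - cos t := fun t ↦ by
      rw [show π + π / 2 - t = (π / 2 - t) + π by ring, sin_add_pi, sin_pi_div_two_sub]
    have s2 : ∀ t, sin (t - π / 2) = - cos t := fun t ↦ sin_sub_pi_div_two t
    simp only [s1, s2, mul_neg, ← sub_eq_add_neg, sub_self, add_sub_cancel_right,
      add_sub_cancel_left, show π - π / 2 = π / 2 by ring] at a1 a2
    rw [← a1, ← a2]
    ring
  rw [e1, e2, ← intervalIntegral.integral_add_adjacent_intervals (b := π / 2)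
      (hc3.intervalIntegrable _ _) (hc3.intervalIntegrable _ _)]
  ring

end SignatureFour
end

/-! ### The real axis: `φ`, `ρ` and the differential equations of `ρ`. -/

noncomputable section
namespace SignatureFour

open Real Filter Topology

/-- Inverting the primitive of a positive, even, periodic function. -/
lemma invFun_primitive {h : ℝ → ℝ} (hc : Continuous h) {m : ℝ} (hm : 0 < m) (hmh : ∀ t, m ≤ h t)
    {P : ℝ} (hP : Function.Periodic h P) (he : ∀ t, h (-t) = h t) {I : ℝ → ℝ}
    (hI : ∀ T, I T = ∫ t in (0 : ℝ)..T, h t) :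
    (∀ T, Function.invFun I (I T) = T) ∧
    (∀ u, I (Function.invFun I u) = u) ∧
    (∀ u, HasDerivAt (Function.invFun I) (h (Function.invFun I u))⁻¹ u) ∧
    (∀ u, Function.invFun I (u + I P) = Function.invFun I u + P) ∧
    (∀ u, Function.invFun I (-u) = -Function.invFun I u) := by
  have hint : ∀ a b, IntervalIntegrable h MeasureTheory.volume a b := hc.intervalIntegrable
  have hd : ∀ T, HasDerivAt I (h T) T := fun T ↦ by
    rw [show I = fun T ↦ ∫ t in (0 : ℝ)..T, h t from funext hI]
    exact intervalIntegral.integral_hasDerivAt_right (hint _ _)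
      (hc.stronglyMeasurableAtFilter _ _) hc.continuousAt
  have hcont : Continuous I := continuous_iff_continuousAt.2 fun T ↦ (hd T).continuousAt
  have hmono : StrictMono I := strictMono_of_deriv_pos fun T ↦ by
    rw [(hd T).deriv]; exact hm.trans_le (hmh T)
  have hodd : ∀ T, I (-T) = -I T := fun T ↦ by
    have := intervalIntegral.integral_comp_neg (a := 0) (b := T) h
    simp only [he, neg_zero] at this
    rw [hI, hI, this, intervalIntegral.integral_symm]
  have hge : ∀ T, 0 ≤ T → m * T ≤ I T := fun T hT ↦ by
    have := intervalIntegral.integral_mono_on hT (intervalIntegrable_const (c := m)) (hint 0 T)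
      fun x _ ↦ hmh x
    rw [hI]
    simpa [mul_comm] using this
  have htop : Tendsto I atTop atTop :=
    tendsto_atTop_mono' _ ((eventually_ge_atTop 0).mono hge)
      (tendsto_id.const_mul_atTop hm)
  have hbot : Tendsto I atBot atBot := by
    have : I = fun T ↦ -I (-T) := funext fun T ↦ by rw [hodd, neg_neg]
    rw [this]
    exact tendsto_neg_atTop_atBot.comp (htop.comp tendsto_neg_atBot_atTop)
  have hsurj : Function.Surjective I := hcont.surjective htop hbot
  have hl : ∀ T, Function.invFun I (I T) = T := Function.leftInverse_invFun hmono.injective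
  have hr : ∀ u, I (Function.invFun I u) = u := Function.rightInverse_invFun hsurj
  have hmono' : Monotone (Function.invFun I) := fun a b hab ↦ by
    rw [← hmono.le_iff_le, hr, hr]; exact hab
  have hcont' : Continuous (Function.invFun I) :=
    hmono'.continuous_of_surjective fun T ↦ ⟨I T, hl T⟩
  have hadd : ∀ T, I (T + P) = I T + I P := fun T ↦ by
    rw [hI, hI T, ← intervalIntegral.integral_add_adjacent_intervals (hint 0 T) (hint T (T + P)),
      hP.intervalIntegral_add_eq T 0, zero_add, hI]
  refine ⟨hl, hr, fun u ↦ ?_, fun u ↦ ?_, fun u ↦ ?_⟩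
  · exact HasDerivAt.of_local_left_inverse hcont'.continuousAt (hd _)
      (hm.trans_le (hmh _)).ne' (.of_forall hr)
  · apply hmono.injective; rw [hr, hadd, hr]
  · apply hmono.injective; rw [hr, hodd, hr]

section Rho

variable {κ l : ℝ}

/-- The length of a period of `ρ`. -/
def realPeriod (κ : ℝ) : ℝ := incompleteIntegral κ π

lemma incompleteIntegral_eq (hκ : |κ| < 1) (T : ℝ) : incompleteIntegral κ T =
    ∫ t in (0 : ℝ)..T, (1 / √(1 - κ * sin t) + 1 / √(1 + κ * sin t)) / 2 := by
  unfold incompleteIntegral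
  congr 1
  funext t
  rw [← mul_pow, ordinaryHypergeometric_quarter_sq (abs_mul_lt_one hκ (abs_sin_le_one t))]

lemma realPeriod_eq (hκ : |κ| < 1) : realPeriod κ = π * completeF (κ ^ 2) := by
  rw [realPeriod, incompleteIntegral_eq hκ, integral_quarter hκ]

lemma half_le_inv_sqrt {x : ℝ} (hx : 0 < x) (hx4 : x ≤ 4) : 1 / 2 ≤ 1 / √x := by
  have : √x ≤ 2 := Real.sqrt_le_iff.2 ⟨by norm_num, by linarith⟩
  exact one_div_le_one_div_of_le (Real.sqrt_pos.2 hx) this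

lemma phi_spec (hκ : |κ| < 1) :
    (∀ T, phi κ (incompleteIntegral κ T) = T) ∧
    (∀ u, incompleteIntegral κ (phi κ u) = u) ∧
    (∀ u, HasDerivAt (phi κ)
      ((1 / √(1 - κ * sin (phi κ u)) + 1 / √(1 + κ * sin (phi κ u))) / 2)⁻¹ u) ∧
    (∀ u, phi κ (u + realPeriod κ) = phi κ u + π) ∧
    (∀ u, phi κ (-u) = -phi κ u) := by
  have h1 : Continuous fun t ↦ 1 / √(1 - κ * sin t) :=
    continuous_inv_sqrt_one_sub_mul hκ continuous_sin abs_sin_le_one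
  have h2 : Continuous fun t ↦ 1 / √(1 + κ * sin t) := by
    simpa using continuous_inv_sqrt_one_sub_mul (k := -κ) (by simpa using hκ) continuous_sin
      abs_sin_le_one
  -- The lower bound `1/2` only needs `1 ± κ sin t ≤ 4`.
  refine invFun_primitive (h := fun t ↦ (1 / √(1 - κ * sin t) + 1 / √(1 + κ * sin t)) / 2)
    (by fun_prop) (m := 1 / 2) (by norm_num) (fun t ↦ ?_) (fun t ↦ ?_) (fun t ↦ ?_)
    (incompleteIntegral_eq hκ)
  · have := abs_lt.1 (abs_mul_lt_one hκ (abs_sin_le_one t))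
    have a1 := half_le_inv_sqrt (x := 1 - κ * sin t) (by linarith) (by linarith)
    have a2 := half_le_inv_sqrt (x := 1 + κ * sin t) (by linarith) (by linarith)
    linarith
  · simp only [sin_add_pi, mul_neg, sub_neg_eq_add, ← sub_eq_add_neg]
    ring
  · simp only [sin_neg, mul_neg, sub_neg_eq_add, ← sub_eq_add_neg]
    ring

/-- The derivative of `ρ`. -/
def rhoDeriv (κ : ℝ) (u : ℝ) : ℝ :=
  -(κ ^ 2 * sin (phi κ u) * cos (phi κ u)) / √((1 + rho κ u) / 2)

lemma rho_eq_sqrt (u : ℝ) : rho κ u = √(1 - (κ * sin (phi κ u)) ^ 2) := by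
  rw [rho, psi, cos_arcsin]

lemma rho_sq (hκ : |κ| < 1) (u : ℝ) : rho κ u ^ 2 = 1 - (κ * sin (phi κ u)) ^ 2 := by
  rw [rho_eq_sqrt, Real.sq_sqrt]
  have := abs_lt.1 (abs_mul_lt_one hκ (abs_sin_le_one (phi κ u)))
  nlinarith

lemma rho_pos (hκ : |κ| < 1) (u : ℝ) : 0 < rho κ u := by
  rw [rho_eq_sqrt]
  have := abs_lt.1 (abs_mul_lt_one hκ (abs_sin_le_one (phi κ u)))
  exact Real.sqrt_pos.2 (by nlinarith)

lemma rho_le_one (u : ℝ) : rho κ u ≤ 1 := Real.cos_le_one _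

lemma le_rho (hκ : |κ| < 1) (hl : l ^ 2 = 1 - κ ^ 2) (u : ℝ) : l ≤ rho κ u := by
  refine le_of_sq_le_sq ?_ (rho_pos hκ u).le
  rw [rho_sq hκ, hl, mul_pow]
  nlinarith [sin_sq_le_one (phi κ u), sq_nonneg κ]

/-- With `s = κ sin φ` one has `ρ = √(1 - s) √(1 + s)`, and squaring gives `(√(1 - s) + √(1 + s))/2
= √((1 + ρ)/2)`; so the reciprocal of the integrand depends on `ρ` alone. -/
lemma hasDerivAt_phi (hκ : |κ| < 1) (u : ℝ) :
    HasDerivAt (phi κ) (rho κ u / √((1 + rho κ u) / 2)) u := by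
  have h := (phi_spec hκ).2.2.1 u
  have hs := abs_lt.1 (abs_mul_lt_one hκ (abs_sin_le_one (phi κ u)))
  have hρ := rho_eq_sqrt (κ := κ) u
  set s := κ * sin (phi κ u)
  have ha : 0 < √(1 - s) := Real.sqrt_pos.2 (by linarith)
  have hb : 0 < √(1 + s) := Real.sqrt_pos.2 (by linarith)
  have hab : rho κ u = √(1 - s) * √(1 + s) := by
    rw [hρ, ← Real.sqrt_mul (by linarith)]; ring_nf
  have hr : √((1 + rho κ u) / 2) = (√(1 - s) + √(1 + s)) / 2 := by
    rw [Real.sqrt_eq_iff_mul_self_eq_of_pos (by positivity), hab]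
    have e1 := Real.sq_sqrt (show 0 ≤ 1 - s by linarith)
    have e2 := Real.sq_sqrt (show 0 ≤ 1 + s by linarith)
    linear_combination (e1 + e2) / 4
  convert! h using 1
  rw [hr, hab]
  field_simp
  ring

lemma sqrt_rho_pos (hκ : |κ| < 1) (u : ℝ) : 0 < √((1 + rho κ u) / 2) :=
  Real.sqrt_pos.2 (by linarith [rho_pos hκ u])

lemma sqrt_rho_sq (hκ : |κ| < 1) (u : ℝ) : √((1 + rho κ u) / 2) ^ 2 = (1 + rho κ u) / 2 :=
  Real.sq_sqrt (by linarith [rho_pos hκ u])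

lemma hasDerivAt_rho (hκ : |κ| < 1) (u : ℝ) : HasDerivAt (rho κ) (rhoDeriv κ u) u := by
  have h1 := ((((hasDerivAt_phi hκ u).sin.const_mul κ).pow 2).const_sub 1).sqrt
    (by rw [Pi.pow_apply, ← rho_sq hκ]; exact (pow_pos (rho_pos hκ u) 2).ne')
  have e : (fun y ↦ √(1 - ((fun y ↦ κ * sin (phi κ y)) ^ 2) y)) = rho κ :=
    funext fun y ↦ (rho_eq_sqrt y).symm
  rw [e] at h1
  convert! h1 using 1
  have hp := rho_pos hκ u
  have hr := sqrt_rho_pos hκ u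
  simp only [Pi.pow_apply]
  rw [← rho_eq_sqrt, rhoDeriv]
  field_simp
  ring

lemma rhoDeriv_sq (hκ : |κ| < 1) (hl : l ^ 2 = 1 - κ ^ 2) (u : ℝ) :
    rhoDeriv κ u ^ 2 = 2 * (1 - rho κ u) * (rho κ u ^ 2 - l ^ 2) := by
  have hr := sqrt_rho_sq hκ u
  have hp := rho_pos hκ u
  have hs := rho_sq hκ u
  have hc : κ ^ 2 * cos (phi κ u) ^ 2 = rho κ u ^ 2 - l ^ 2 := by
    rw [hs, cos_sq', hl]; ring
  rw [rhoDeriv, div_pow, hr, div_eq_iff (by positivity), ← hc]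
  have : κ ^ 2 * sin (phi κ u) ^ 2 = (1 - rho κ u) * (1 + rho κ u) := by linarith
  linear_combination (κ ^ 2 * cos (phi κ u) ^ 2) * this

/-- Differentiating the first-order equation would lose the zeros of `rhoDeriv`, so the explicit
quotient is differentiated instead. -/
lemma hasDerivAt_rhoDeriv (hκ : |κ| < 1) (hl : l ^ 2 = 1 - κ ^ 2) (u : ℝ) :
    HasDerivAt (rhoDeriv κ) (-3 * rho κ u ^ 2 + 2 * rho κ u + l ^ 2) u := by
  have hp := rho_pos hκ u
  have hφ := hasDerivAt_phi hκ u
  have h := (((hφ.sin.const_mul (κ ^ 2)).mul hφ.cos).neg).div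
    ((((hasDerivAt_rho hκ u).const_add 1).div_const 2).sqrt (by positivity))
    (sqrt_rho_pos hκ u).ne'
  convert! h using 1
  have hr := sqrt_rho_sq hκ u
  have hr0 := sqrt_rho_pos hκ u
  have hs := rho_sq hκ u
  have hcs := cos_sq' (phi κ u)
  simp only [Pi.mul_apply, Pi.neg_apply]
  rw [rhoDeriv]
  set r := √((1 + rho κ u) / 2)
  set s := sin (phi κ u)
  set c := cos (phi κ u)
  have hρ : rho κ u = 2 * r ^ 2 - 1 := by linarith
  have hκs : κ ^ 2 * s ^ 2 = 1 - rho κ u ^ 2 := by linarith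
  have hκc : κ ^ 2 * c ^ 2 = rho κ u ^ 2 - l ^ 2 := by rw [hcs]; linarith
  have key : (κ ^ 2 * (c * (rho κ u / r)) * c + κ ^ 2 * s * (-s * (rho κ u / r))) =
      (2 * rho κ u ^ 2 - 1 - l ^ 2) * rho κ u / r := by
    field_simp
    linear_combination (hκc - hκs)
  have key2 : (κ ^ 2 * s * c) ^ 2 = (1 - rho κ u ^ 2) * (rho κ u ^ 2 - l ^ 2) := by
    rw [← hκs, ← hκc]; ring
  have e : (-(κ ^ 2 * (c * (rho κ u / r)) * c + κ ^ 2 * s * (-s * (rho κ u / r))) * r -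
      -(κ ^ 2 * s * c) * (-(κ ^ 2 * s * c) / r / 2 / (2 * r))) / r ^ 2 =
      -(2 * rho κ u ^ 2 - 1 - l ^ 2) * rho κ u / r ^ 2 - (κ ^ 2 * s * c) ^ 2 / (4 * r ^ 4) := by
    rw [key]; field_simp; ring
  rw [e, key2, eq_sub_iff_add_eq, eq_div_iff (by positivity), hρ]
  field_simp
  ring

lemma rho_neg (hκ : |κ| < 1) (u : ℝ) : rho κ (-u) = rho κ u := by
  rw [rho_eq_sqrt, rho_eq_sqrt, (phi_spec hκ).2.2.2.2, sin_neg, mul_neg, neg_sq]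

lemma rho_add_realPeriod (hκ : |κ| < 1) (u : ℝ) : rho κ (u + realPeriod κ) = rho κ u := by
  rw [rho_eq_sqrt, rho_eq_sqrt, (phi_spec hκ).2.2.2.1, sin_add_pi, mul_neg, neg_sq]

lemma rho_incompleteIntegral (hκ : |κ| < 1) (T : ℝ) :
    rho κ (incompleteIntegral κ T) = √(1 - (κ * sin T) ^ 2) := by
  rw [rho_eq_sqrt, (phi_spec hκ).1]

lemma rho_zero (hκ : |κ| < 1) : rho κ 0 = 1 := by
  have := rho_incompleteIntegral hκ 0
  simpa [incompleteIntegral] using this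

lemma incompleteIntegral_int_mul_pi (hκ : |κ| < 1) (n : ℤ) :
    incompleteIntegral κ (n * π) = n * realPeriod κ := by
  obtain ⟨hl, hr, -, hp, -⟩ := phi_spec hκ
  have hinj : Function.Injective (phi κ) := fun a b h ↦ by rw [← hr a, h, hr]
  have hadd (T : ℝ) : incompleteIntegral κ (T + π) = incompleteIntegral κ T + realPeriod κ := by
    apply hinj; rw [hl, hp, hl]
  induction n with
  | zero => simp [incompleteIntegral]
  | succ i ih =>
    push_cast at ih ⊢
    rw [add_one_mul, hadd, ih]; ring
  | pred i ih =>
    have := hadd ((-i - 1 : ℝ) * π)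
    push_cast at ih ⊢
    rw [show (-(i : ℝ) - 1) * π + π = -i * π by ring, ih] at this
    linarith

lemma rho_eq_one (hκ : |κ| < 1) (hκ0 : κ ≠ 0) {u : ℝ} (hu : rho κ u = 1) :
    ∃ n : ℤ, u = n * realPeriod κ := by
  have h := rho_sq hκ u
  rw [hu] at h
  have hs : sin (phi κ u) = 0 := by
    have : (κ * sin (phi κ u)) ^ 2 = 0 := by linarith
    simpa [hκ0] using this
  obtain ⟨n, hn⟩ := sin_eq_zero_iff.1 hs
  refine ⟨n, ?_⟩
  rw [← incompleteIntegral_int_mul_pi hκ, hn, (phi_spec hκ).2.1]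

end Rho

end SignatureFour
end

/-! ### The imaginary axis: a pendulum equation. -/

noncomputable section
namespace SignatureFour

open Real Filter Topology

section Tau

variable {l : ℝ}

/-- The time map of the pendulum equation `θ'² = 2 (1 - l cos θ)`. -/
def pendulumIntegral (l T : ℝ) : ℝ := ∫ t in (0 : ℝ)..T, 1 / √2 * (1 / √(1 - l * cos t))

/-- The solution of `θ'² = 2 (1 - l cos θ)` with `θ(0) = 0`. -/
def pendulum (l : ℝ) : ℝ → ℝ := Function.invFun (pendulumIntegral l)

/-- The length of a period of `l cos θ`. -/
def imagPeriod (l : ℝ) : ℝ := pendulumIntegral l (2 * π)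

lemma continuous_pendulum_integrand (hl : |l| < 1) :
    Continuous fun t ↦ 1 / √2 * (1 / √(1 - l * cos t)) :=
  (continuous_inv_sqrt_one_sub_mul hl continuous_cos abs_cos_le_one).const_mul _

lemma pendulum_spec (hl : |l| < 1) :
    (∀ T, pendulum l (pendulumIntegral l T) = T) ∧
    (∀ u, pendulumIntegral l (pendulum l u) = u) ∧
    (∀ u, HasDerivAt (pendulum l) (1 / √2 * (1 / √(1 - l * cos (pendulum l u))))⁻¹ u) ∧
    (∀ u, pendulum l (u + imagPeriod l) = pendulum l u + 2 * π) ∧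
    (∀ u, pendulum l (-u) = -pendulum l u) := by
  refine invFun_primitive (h := fun t ↦ 1 / √2 * (1 / √(1 - l * cos t)))
    (continuous_pendulum_integrand hl) (m := 1 / √2 * (1 / 2)) (by positivity)
    (fun t ↦ ?_) (fun t ↦ ?_) (fun t ↦ ?_) (fun _ ↦ rfl)
  · have := abs_lt.1 (abs_mul_lt_one hl (abs_cos_le_one t))
    have a1 := half_le_inv_sqrt (x := 1 - l * cos t) (by linarith) (by linarith)
    gcongr
  · simp only [cos_add_two_pi]
  · simp only [cos_neg]

/-- This is the source of the factor `√2` and, since `l² = 1 - κ²`, of the complementary argument.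
-/
lemma pendulumIntegral_pi (hl : |l| < 1) :
    pendulumIntegral l π = √2 / 2 * π * completeF (l ^ 2) := by
  rw [pendulumIntegral, intervalIntegral.integral_const_mul, integral_inv_sqrt_one_sub_cos hl,
    show 1 / √2 = √2 / 2 by
      rw [div_eq_div_iff (by positivity) (by norm_num), Real.mul_self_sqrt (by norm_num)]
      norm_num]
  ring

lemma imagPeriod_eq (hl : |l| < 1) : imagPeriod l = 2 * pendulumIntegral l π := by
  have hint := (continuous_pendulum_integrand hl).intervalIntegrable
    (μ := MeasureTheory.volume)
  rw [imagPeriod, pendulumIntegral, pendulumIntegral,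
    ← intervalIntegral.integral_add_adjacent_intervals (hint 0 π) (hint π (2 * π))]
  have := intervalIntegral.integral_comp_sub_left (a := 0) (b := π)
    (fun t ↦ 1 / √2 * (1 / √(1 - l * cos t))) (2 * π)
  simp only [cos_two_pi_sub, show 2 * π - π = π by ring, sub_zero] at this
  rw [← this]
  ring

/-- The function `τ = l cos θ`. -/
def tau (l y : ℝ) : ℝ := l * cos (pendulum l y)

/-- The derivative of `τ`. -/
def tauDeriv (l y : ℝ) : ℝ :=
  -(l * sin (pendulum l y)) * (√2 * √(1 - l * cos (pendulum l y)))

lemma hasDerivAt_pendulum (hl : |l| < 1) (y : ℝ) :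
    HasDerivAt (pendulum l) (√2 * √(1 - l * cos (pendulum l y))) y := by
  convert! (pendulum_spec hl).2.2.1 y using 1
  simp [mul_comm]

lemma one_sub_tau_pos (hl : |l| < 1) (y : ℝ) : 0 < 1 - tau l y := by
  have := abs_lt.1 (abs_mul_lt_one hl (abs_cos_le_one (pendulum l y)))
  rw [tau]; linarith

lemma hasDerivAt_tau (hl : |l| < 1) (y : ℝ) : HasDerivAt (tau l) (tauDeriv l y) y := by
  convert! (hasDerivAt_pendulum hl y).cos.const_mul l using 1
  rw [tauDeriv]; ring

lemma tauDeriv_sq (hl : |l| < 1) (y : ℝ) :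
    tauDeriv l y ^ 2 = 2 * (1 - tau l y) * (l ^ 2 - tau l y ^ 2) := by
  have h1 := Real.sq_sqrt (one_sub_tau_pos hl y).le
  have h2 := Real.sq_sqrt (show (0 : ℝ) ≤ 2 by norm_num)
  rw [tau] at h1
  rw [tauDeriv, mul_pow, mul_pow (√2), h1, h2, tau, neg_sq, mul_pow, sin_sq]
  ring

lemma hasDerivAt_tauDeriv (hl : |l| < 1) (y : ℝ) :
    HasDerivAt (tauDeriv l) (3 * tau l y ^ 2 - 2 * tau l y - l ^ 2) y := by
  have hθ := hasDerivAt_pendulum hl y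
  have h0 := one_sub_tau_pos hl y
  have h := (hθ.sin.const_mul l).neg.mul
    (((hasDerivAt_tau hl y).const_sub 1).sqrt h0.ne' |>.const_mul √2)
  convert! h using 1
  have h1 := Real.sq_sqrt h0.le
  have h2 := Real.sq_sqrt (show (0 : ℝ) ≤ 2 by norm_num)
  have hs := sin_sq (pendulum l y)
  have h3 := Real.sqrt_pos.2 h0
  simp only [Pi.neg_apply]
  rw [tauDeriv, ← tau]
  set r := √(1 - tau l y)
  set q := √(2 : ℝ)
  set s := sin (pendulum l y)
  have hτ : l * cos (pendulum l y) = tau l y := rfl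
  have e : -(l * s) * (q * (-(-(l * s) * (q * r)) / (2 * r))) = -(l ^ 2 * s ^ 2) := by
    field_simp
    linear_combination (-(l ^ 2 * s ^ 2)) * h2
  rw [e, hs]
  have e2 : -(l * (cos (pendulum l y) * (q * r))) * (q * r) = -2 * tau l y * (1 - tau l y) := by
    rw [← h1, ← hτ]
    linear_combination (-l * cos (pendulum l y) * r ^ 2) * h2
  have hc2 : l ^ 2 * cos (pendulum l y) ^ 2 = tau l y ^ 2 := by rw [← hτ]; ring
  rw [e2]
  linear_combination -hc2

lemma tau_neg (hl : |l| < 1) (y : ℝ) : tau l (-y) = tau l y := by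
  rw [tau, tau, (pendulum_spec hl).2.2.2.2, cos_neg]

lemma tau_add_imagPeriod (hl : |l| < 1) (y : ℝ) : tau l (y + imagPeriod l) = tau l y := by
  rw [tau, tau, (pendulum_spec hl).2.2.2.1, cos_add_two_pi]

lemma tau_zero (hl : |l| < 1) : tau l 0 = l := by
  have := (pendulum_spec hl).1 0
  rw [show pendulumIntegral l 0 = 0 by simp [pendulumIntegral]] at this
  simp [tau, this]

lemma tau_half (hl : |l| < 1) : tau l (pendulumIntegral l π) = -l := by
  simp [tau, (pendulum_spec hl).1 π]

lemma pendulumIntegral_int_mul (hl : |l| < 1) (n : ℤ) :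
    pendulumIntegral l (n * (2 * π)) = n * imagPeriod l := by
  obtain ⟨hi, hr, -, hp, -⟩ := pendulum_spec hl
  have hinj : Function.Injective (pendulum l) := fun a b h ↦ by rw [← hr a, h, hr]
  have hadd (T : ℝ) : pendulumIntegral l (T + 2 * π) = pendulumIntegral l T + imagPeriod l := by
    apply hinj; rw [hi, hp, hi]
  induction n with
  | zero => simp [pendulumIntegral]
  | succ i ih =>
    push_cast at ih ⊢
    rw [add_one_mul, hadd, ih]; ring
  | pred i ih =>
    have := hadd ((-i - 1 : ℝ) * (2 * π))
    push_cast at ih ⊢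
    rw [show (-(i : ℝ) - 1) * (2 * π) + 2 * π = -i * (2 * π) by ring, ih] at this
    linarith

lemma tau_eq (hl : |l| < 1) (hl0 : l ≠ 0) {y : ℝ} (hy : tau l y = l) :
    ∃ n : ℤ, y = n * imagPeriod l := by
  have hc : cos (pendulum l y) = 1 := by
    rw [tau] at hy
    exact mul_left_cancel₀ hl0 (by linarith)
  obtain ⟨n, hn⟩ := (cos_eq_one_iff _).1 hc
  refine ⟨n, ?_⟩
  rw [← pendulumIntegral_int_mul hl, hn, (pendulum_spec hl).2.1]

end Tau

/-! ### The data on both axes, with `σ` a half-period translate of `ρ`. -/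

/-- The real functions from which the Weierstrass function is built by the addition theorem:
`σ` and `τ` solve `σ'² = 2 (1 - σ) (σ² - l²)` and `τ'² = 2 (1 - τ) (l² - τ²)` with initial
value `l` at the origin, and they have period `W` and `V`. -/
structure AxisFunctions (l W V : ℝ) (σ σ₁ τ τ₁ : ℝ → ℝ) : Prop where
  l_pos : 0 < l
  l_lt : l < 1
  W_pos : 0 < W
  V_pos : 0 < V
  σ_deriv : ∀ x, HasDerivAt σ (σ₁ x) x
  σ₁_deriv : ∀ x, HasDerivAt σ₁ (-3 * σ x ^ 2 + 2 * σ x + l ^ 2) x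
  σ_sq : ∀ x, σ₁ x ^ 2 = 2 * (1 - σ x) * (σ x ^ 2 - l ^ 2)
  σ_ge : ∀ x, l ≤ σ x
  σ_le : ∀ x, σ x ≤ 1
  σ_zero : σ 0 = l
  σ_neg : ∀ x, σ (-x) = σ x
  σ_add : ∀ x, σ (x + W) = σ x
  σ_eq : ∀ x, σ x = l → ∃ n : ℤ, x = n * W
  τ_deriv : ∀ x, HasDerivAt τ (τ₁ x) x
  τ₁_deriv : ∀ x, HasDerivAt τ₁ (3 * τ x ^ 2 - 2 * τ x - l ^ 2) x
  τ_sq : ∀ x, τ₁ x ^ 2 = 2 * (1 - τ x) * (l ^ 2 - τ x ^ 2)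
  τ_ge : ∀ x, -l ≤ τ x
  τ_le : ∀ x, τ x ≤ l
  τ_zero : τ 0 = l
  τ_neg : ∀ x, τ (-x) = τ x
  τ_add : ∀ x, τ (x + V) = τ x
  τ_eq : ∀ x, τ x = l → ∃ n : ℤ, x = n * V

/-- The translate of `ρ` by half a period. -/
def sigma (κ l x : ℝ) : ℝ := -l + 2 * l * (1 + l) / (rho κ x + l)

/-- The derivative of `sigma`. -/
def sigmaDeriv (κ l x : ℝ) : ℝ := -(2 * l * (1 + l) * rhoDeriv κ x) / (rho κ x + l) ^ 2

lemma realPeriod_pos {κ : ℝ} (hκ : |κ| < 1) : 0 < realPeriod κ := by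
  have h1 : Continuous fun t ↦ 1 / √(1 - κ * sin t) :=
    continuous_inv_sqrt_one_sub_mul hκ continuous_sin abs_sin_le_one
  have h2 : Continuous fun t ↦ 1 / √(1 + κ * sin t) := by
    simpa using continuous_inv_sqrt_one_sub_mul (k := -κ) (by simpa using hκ) continuous_sin
      abs_sin_le_one
  rw [realPeriod, incompleteIntegral_eq hκ]
  refine intervalIntegral.intervalIntegral_pos_of_pos (Continuous.intervalIntegrable
    (by fun_prop) _ _) (fun t ↦ ?_) pi_pos
  have := abs_lt.1 (abs_mul_lt_one hκ (abs_sin_le_one t))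
  have a1 : 0 < √(1 - κ * sin t) := Real.sqrt_pos.2 (by linarith)
  have a2 : 0 < √(1 + κ * sin t) := Real.sqrt_pos.2 (by linarith)
  positivity

lemma completeF_pos {k : ℝ} (hk : |k| < 1) : 0 < completeF (k ^ 2) := by
  have := realPeriod_pos hk
  rw [realPeriod_eq hk] at this
  exact pos_of_mul_pos_right this pi_pos.le

lemma imagPeriod_pos {l : ℝ} (hl : |l| < 1) : 0 < imagPeriod l := by
  have := completeF_pos hl
  rw [imagPeriod_eq hl, pendulumIntegral_pi hl]
  have := pi_pos
  positivity

lemma axisFunctions {κ l : ℝ} (hκ0 : 0 < κ) (hκ : κ < 1) (hl0 : 0 < l) (hl : l ^ 2 = 1 - κ ^ 2) :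
    AxisFunctions l (realPeriod κ) (imagPeriod l) (sigma κ l) (sigmaDeriv κ l)
      (tau l) (tauDeriv l) := by
  have hl1 : l < 1 := by nlinarith
  have hκ' : |κ| < 1 := by rwa [abs_of_pos hκ0]
  have hl' : |l| < 1 := by rwa [abs_of_pos hl0]
  have hpos (x : ℝ) : 0 < rho κ x + l := by linarith [rho_pos hκ' x]
  have hd (x : ℝ) : HasDerivAt (sigma κ l) (sigmaDeriv κ l x) x := by
    -- `sigma` is a Möbius function of `ρ`, `(σ + l)(ρ + l) = 2l(1 + l)`, as translation by a half
    -- period acts on an even elliptic function of order two. It swaps `1` with `l` and `-l` with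
    -- `∞`, hence preserves the differential equation.
    convert! ((hasDerivAt_const x (2 * l * (1 + l))).div ((hasDerivAt_rho hκ' x).add_const l)
      (hpos x).ne').const_add (-l) using 1
    rw [sigmaDeriv]; ring
  exact {
    l_pos := hl0
    l_lt := hl1
    W_pos := realPeriod_pos hκ'
    V_pos := imagPeriod_pos hl'
    σ_deriv := hd
    σ₁_deriv := fun x ↦ by
      have h := (((hasDerivAt_rhoDeriv hκ' hl x).const_mul (2 * l * (1 + l))).neg).div
        (((hasDerivAt_rho hκ' x).add_const l).pow 2) (by simpa using (hpos x).ne')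
      convert! h using 1
      have hp := hpos x
      have hs := rhoDeriv_sq hκ' hl x
      simp only [Pi.pow_apply, Pi.neg_apply]
      rw [sigma, eq_div_iff (by positivity)]
      field_simp
      linear_combination (-4 * (rho κ x + l) * (1 + l)) * hs
    σ_sq := fun x ↦ by
      have hp := hpos x
      rw [sigmaDeriv, sigma, div_pow, neg_sq, mul_pow, rhoDeriv_sq hκ' hl]
      field_simp
      ring
    σ_ge := fun x ↦ by
      have h1 := rho_le_one (κ := κ) x
      have : 2 * l ≤ 2 * l * (1 + l) / (rho κ x + l) := by
        rw [le_div_iff₀ (hpos x)]; gcongr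
      rw [sigma]; linarith
    σ_le := fun x ↦ by
      have h1 := le_rho hκ' hl x
      have : 2 * l * (1 + l) / (rho κ x + l) ≤ 1 + l := by
        rw [div_le_iff₀ (hpos x)]; nlinarith
      rw [sigma]; linarith
    σ_zero := by
      rw [sigma, rho_zero hκ', mul_div_assoc, div_self (by positivity)]; ring
    σ_neg := fun x ↦ by rw [sigma, sigma, rho_neg hκ']
    σ_add := fun x ↦ by rw [sigma, sigma, rho_add_realPeriod hκ']
    σ_eq := fun x hx ↦ by
      refine rho_eq_one hκ' hκ0.ne' ?_
      have hp := hpos x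
      rw [sigma, neg_add_eq_iff_eq_add, div_eq_iff hp.ne'] at hx
      have : 2 * l * (rho κ x - 1) = 0 := by linarith
      have := (mul_eq_zero.1 this).resolve_left (by positivity)
      linarith
    τ_deriv := hasDerivAt_tau hl'
    τ₁_deriv := hasDerivAt_tauDeriv hl'
    τ_sq := tauDeriv_sq hl'
    τ_ge := fun x ↦ by rw [tau]; nlinarith [neg_one_le_cos (pendulum l x)]
    τ_le := fun x ↦ by rw [tau]; nlinarith [cos_le_one (pendulum l x)]
    τ_zero := tau_zero hl'
    τ_neg := tau_neg hl'
    τ_add := tau_add_imagPeriod hl'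
    τ_eq := fun x hx ↦ tau_eq hl' hl0.ne' hx }

end SignatureFour
end

/-! ### The addition formula: holomorphy, periodicity and size at the origin. -/

noncomputable section
namespace SignatureFour

open Real Filter Topology

/-- A function vanishing to second order is asymptotic to half its second derivative times `x²`. -/
lemma tendsto_div_sq_of_hasDerivAt {g g₁ : ℝ → ℝ} {q : ℝ} (hg : ∀ x, HasDerivAt g (g₁ x) x)
    (hg₁ : HasDerivAt g₁ q 0) (h0 : g 0 = 0) (h1 : g₁ 0 = 0) :
    Tendsto (fun x ↦ g x / x ^ 2) (𝓝[≠] 0) (𝓝 (q / 2)) := by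
  refine HasDerivAt.lhopital_zero_nhdsNE (f' := g₁) (g' := fun x ↦ 2 * x)
    (.of_forall hg) (.of_forall fun x ↦ by simpa using hasDerivAt_pow 2 x) ?_ ?_ ?_ ?_
  · filter_upwards [self_mem_nhdsWithin] with x hx
    exact mul_ne_zero two_ne_zero hx
  · have := (hg 0).continuousAt.tendsto
    rw [h0] at this
    exact this.mono_left nhdsWithin_le_nhds
  · have : Tendsto (fun x : ℝ ↦ x ^ 2) (𝓝 0) (𝓝 (0 ^ 2)) := (continuous_pow 2).tendsto 0
    rw [zero_pow two_ne_zero] at this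
    exact this.mono_left nhdsWithin_le_nhds
  · have := (hasDerivAt_iff_tendsto_slope.1 hg₁).div_const 2
    refine this.congr' ?_
    filter_upwards [self_mem_nhdsWithin] with x hx
    rw [slope_def_field, h1]
    have : x ≠ 0 := hx
    field_simp
    ring

lemma eventually_mul_sq_le {g g₁ : ℝ → ℝ} {q : ℝ} (hg : ∀ x, HasDerivAt g (g₁ x) x)
    (hg₁ : HasDerivAt g₁ q 0) (h0 : g 0 = 0) (h1 : g₁ 0 = 0) (hq : 0 < q) :
    ∀ᶠ x in 𝓝 0, q / 4 * x ^ 2 ≤ g x := by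
  have := (tendsto_div_sq_of_hasDerivAt hg hg₁ h0 h1).eventually_const_lt
    (show q / 4 < q / 2 by linarith)
  rw [eventually_nhdsWithin_iff] at this
  filter_upwards [this] with x hx
  by_cases hx0 : x = 0
  · simp [hx0, h0]
  · have := hx hx0
    rw [lt_div_iff₀ (by positivity)] at this
    exact this.le

namespace AxisFunctions

variable {l W V : ℝ} {σ σ₁ τ τ₁ : ℝ → ℝ} (A : AxisFunctions l W V σ σ₁ τ τ₁)

/-- The value of the Weierstrass function at `x + i y`, by the addition theorem. -/
def addition (σ σ₁ τ τ₁ : ℝ → ℝ) (z : ℂ) : ℂ :=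
  -1 / 3 + ((σ z.re : ℂ) + τ z.im) / 2 +
    1 / 4 * (((σ₁ z.re : ℂ) + Complex.I * τ₁ z.im) / ((σ z.re : ℂ) - τ z.im)) ^ 2

include A

lemma σ₁_neg (x : ℝ) : σ₁ (-x) = -σ₁ x := by
  have h := (A.σ_deriv (-x)).comp x (hasDerivAt_neg x)
  rw [show σ ∘ Neg.neg = σ from funext A.σ_neg] at h
  have := h.unique (A.σ_deriv x)
  linarith

lemma τ₁_neg (x : ℝ) : τ₁ (-x) = -τ₁ x := by
  have h := (A.τ_deriv (-x)).comp x (hasDerivAt_neg x)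
  rw [show τ ∘ Neg.neg = τ from funext A.τ_neg] at h
  have := h.unique (A.τ_deriv x)
  linarith

lemma σ₁_add (x : ℝ) : σ₁ (x + W) = σ₁ x := by
  have h := (A.σ_deriv (x + W)).comp_add_const x W
  rw [show (fun x ↦ σ (x + W)) = σ from funext A.σ_add] at h
  exact h.unique (A.σ_deriv x)

lemma τ₁_add (x : ℝ) : τ₁ (x + V) = τ₁ x := by
  have h := (A.τ_deriv (x + V)).comp_add_const x V
  rw [show (fun x ↦ τ (x + V)) = τ from funext A.τ_add] at h
  exact h.unique (A.τ_deriv x)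

lemma σ₁_zero : σ₁ 0 = 0 := by
  have := A.σ₁_neg 0
  rw [neg_zero] at this
  linarith

lemma τ₁_zero : τ₁ 0 = 0 := by
  have := A.τ₁_neg 0
  rw [neg_zero] at this
  linarith

/-- The rectangular lattice spanned by `W` and `i V`. -/
def periodPair : PeriodPair where
  ω₁ := W
  ω₂ := V * Complex.I
  indep := by
    rw [LinearIndependent.pair_iff]
    intro s t h
    have h1 := congrArg Complex.re h
    have h2 := congrArg Complex.im h
    simp at h1 h2
    exact ⟨h1.resolve_right A.W_pos.ne', h2.resolve_right A.V_pos.ne'⟩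

lemma mem_lattice {z : ℂ} : z ∈ A.periodPair.lattice ↔
    ∃ m n : ℤ, (m : ℂ) * W + n * (V * Complex.I) = z := PeriodPair.mem_lattice

lemma σ_int_mul (n : ℤ) : σ (n * W) = l := by
  have := (show Function.Periodic σ W from A.σ_add).int_mul n 0
  rw [zero_add] at this
  rw [this, A.σ_zero]

lemma τ_int_mul (n : ℤ) : τ (n * V) = l := by
  have := (show Function.Periodic τ V from A.τ_add).int_mul n 0
  rw [zero_add] at this
  rw [this, A.τ_zero]

/-- Since `σ ≥ l ≥ τ`, the two values agree only if both equal `l`, which happens only at periods.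
So the denominator of `addition` vanishes exactly on the lattice. -/
lemma mem_lattice_iff {z : ℂ} : z ∈ A.periodPair.lattice ↔ σ z.re = τ z.im := by
  rw [A.mem_lattice]
  constructor
  · rintro ⟨m, n, rfl⟩
    simp [A.σ_int_mul, A.τ_int_mul]
  · intro h
    have h1 := A.σ_ge z.re
    have h2 := A.τ_le z.im
    obtain ⟨m, hm⟩ := A.σ_eq z.re (by linarith)
    obtain ⟨n, hn⟩ := A.τ_eq z.im (by linarith)
    exact ⟨m, n, Complex.ext (by simp [hm]) (by simp [hn])⟩

lemma ofReal_sub_ne_zero {z : ℂ} (hz : z ∉ A.periodPair.lattice) :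
    (σ z.re : ℂ) - τ z.im ≠ 0 := by
  rw [A.mem_lattice_iff] at hz
  rw [sub_ne_zero]
  exact_mod_cast hz

/-- Real differentiability is clear; the Cauchy-Riemann equation compares the derivatives along `1`
and `I`, and reduces to the two first-order equations. -/
lemma differentiableAt_addition {z : ℂ} (hz : z ∉ A.periodPair.lattice) :
    DifferentiableAt ℂ (addition σ σ₁ τ τ₁) z := by
  have hne := A.ofReal_sub_ne_zero hz
  have hre : DifferentiableAt ℝ (fun w : ℂ ↦ w.re) z := Complex.reCLM.differentiableAt
  have him : DifferentiableAt ℝ (fun w : ℂ ↦ w.im) z := Complex.imCLM.differentiableAt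
  have hof : ∀ {g : ℝ → ℝ} {p : ℂ → ℝ}, (∀ x, DifferentiableAt ℝ g x) → DifferentiableAt ℝ p z →
      DifferentiableAt ℝ (fun w : ℂ ↦ (g (p w) : ℂ)) z := fun {g p} hg hp ↦
    Complex.ofRealCLM.differentiableAt.comp z ((hg (p z)).comp z hp)
  have d1 := hof (fun x ↦ (A.σ_deriv x).differentiableAt) hre
  have d2 := hof (fun x ↦ (A.σ₁_deriv x).differentiableAt) hre
  have d3 := hof (fun x ↦ (A.τ_deriv x).differentiableAt) him
  have d4 := hof (fun x ↦ (A.τ₁_deriv x).differentiableAt) him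
  have hd : DifferentiableAt ℝ (addition σ σ₁ τ τ₁) z := by
    unfold addition
    have d5 : DifferentiableAt ℝ (fun w : ℂ ↦ ((σ₁ w.re : ℂ) + Complex.I * τ₁ w.im) /
        ((σ w.re : ℂ) - τ w.im)) z := by
      simp only [div_eq_mul_inv]
      exact (d2.add (d4.const_mul _)).mul ((d1.sub d3).inv hne)
    have d6 : DifferentiableAt ℝ (fun w : ℂ ↦ ((σ w.re : ℂ) + τ w.im) / 2) z := by
      simp only [div_eq_mul_inv]
      exact (d1.add d3).mul_const _
    exact (d6.const_add (-1 / 3 : ℂ)).add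
      ((d5.pow 2).const_mul (1 / 4 : ℂ))
  refine differentiableAt_complex_iff_differentiableAt_real.2 ⟨hd, ?_⟩
  have hline (v : ℂ) : HasDerivAt (fun t : ℝ ↦ addition σ σ₁ τ τ₁ (z + t • v))
      (fderiv ℝ (addition σ σ₁ τ τ₁) z v) 0 := by
    have := hd.hasFDerivAt.hasLineDerivAt v
    exact this
  have s0 : HasDerivAt (fun t : ℝ ↦ (σ (z.re + t) : ℂ)) (σ₁ z.re) 0 := by
    simpa using ((A.σ_deriv (z.re + 0)).comp_const_add z.re 0).ofReal_comp
  have s1 : HasDerivAt (fun t : ℝ ↦ (σ₁ (z.re + t) : ℂ))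
      (-3 * σ z.re ^ 2 + 2 * σ z.re + l ^ 2) 0 := by
    simpa using ((A.σ₁_deriv (z.re + 0)).comp_const_add z.re 0).ofReal_comp
  have t0 : HasDerivAt (fun t : ℝ ↦ (τ (z.im + t) : ℂ)) (τ₁ z.im) 0 := by
    simpa using ((A.τ_deriv (z.im + 0)).comp_const_add z.im 0).ofReal_comp
  have t1 : HasDerivAt (fun t : ℝ ↦ (τ₁ (z.im + t) : ℂ))
      (3 * τ z.im ^ 2 - 2 * τ z.im - l ^ 2) 0 := by
    simpa using ((A.τ₁_deriv (z.im + 0)).comp_const_add z.im 0).ofReal_comp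
  have h1 := (((s0.add_const (τ z.im : ℂ)).div_const 2).const_add (-1 / 3)).add
    ((((s1.add_const (Complex.I * τ₁ z.im)).div (s0.sub_const (τ z.im : ℂ))
      (by simpa using hne)).pow 2).const_mul (1 / 4))
  have h2 := (((t0.const_add (σ z.re : ℂ)).div_const 2).const_add (-1 / 3)).add
    (((((t1.const_mul Complex.I).const_add (σ₁ z.re : ℂ)).div (t0.const_sub (σ z.re : ℂ))
      (by simpa using hne)).pow 2).const_mul (1 / 4))
  have e1 := (hline 1).unique (by
    convert! h1 using 1
    funext t
    simp [addition])
  have e2 := (hline Complex.I).unique (by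
    convert! h2 using 1
    funext t
    simp [addition])
  rw [e1, e2]
  simp only [add_zero, smul_eq_mul, Nat.add_one_sub_one, pow_one, Pi.div_apply]
  have hs : (σ₁ z.re : ℂ) ^ 2 = 2 * (1 - σ z.re) * (σ z.re ^ 2 - l ^ 2) := by
    exact_mod_cast A.σ_sq z.re
  have ht : (τ₁ z.im : ℂ) ^ 2 = 2 * (1 - τ z.im) * (l ^ 2 - τ z.im ^ 2) := by
    exact_mod_cast A.τ_sq z.im
  generalize (σ z.re : ℂ) = s at *
  generalize (τ z.im : ℂ) = t at *
  generalize (σ₁ z.re : ℂ) = s1 at *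
  generalize (τ₁ z.im : ℂ) = t1 at *
  have hI := Complex.I_sq
  -- These are the numerators of the derivatives of the squared quotient's base along `I` and `1`.
  -- The surplus `I (s - t)³` cancels the mismatch coming from the term `(σ + τ)/2`.
  have key : Complex.I * (3 * t ^ 2 - 2 * t - l ^ 2) * (s - t) - (s1 + Complex.I * t1) * -t1 =
      Complex.I * ((-3 * s ^ 2 + 2 * s + l ^ 2) * (s - t) - (s1 + Complex.I * t1) * s1) +
        Complex.I * (s - t) ^ 3 := by
    linear_combination Complex.I * hs + Complex.I * ht + s1 * t1 * hI
  rw [key]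
  field_simp
  linear_combination 4 * t1 * (s - t) ^ 3 * hI

lemma addition_neg (z : ℂ) : addition σ σ₁ τ τ₁ (-z) = addition σ σ₁ τ τ₁ z := by
  simp only [addition, Complex.neg_re, Complex.neg_im, A.σ_neg, A.τ_neg, A.σ₁_neg, A.τ₁_neg]
  push_cast
  ring

lemma addition_add {w : ℂ} (hw : w ∈ A.periodPair.lattice) (z : ℂ) :
    addition σ σ₁ τ τ₁ (z + w) = addition σ σ₁ τ τ₁ z := by
  obtain ⟨m, n, rfl⟩ := A.mem_lattice.1 hw
  have p1 := (show Function.Periodic σ W from A.σ_add).int_mul m z.re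
  have p2 := (show Function.Periodic σ₁ W from A.σ₁_add).int_mul m z.re
  have p3 := (show Function.Periodic τ V from A.τ_add).int_mul n z.im
  have p4 := (show Function.Periodic τ₁ V from A.τ₁_add).int_mul n z.im
  simp [addition, p1, p2, p3, p4]

/-- The squared modulus of the numerator is `σ₁² + τ₁²`, which is divisible by `σ - τ`; hence the
pole is of first order in `σ - τ`, not second. -/
lemma norm_addition_le {z : ℂ} (hz : z ∉ A.periodPair.lattice) :
    ‖addition σ σ₁ τ τ₁ z‖ ≤ 4 / 3 + 3 / 2 / (σ z.re - τ z.im) := by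
  have a1 := A.σ_ge z.re
  have a2 := A.σ_le z.re
  have a3 := A.τ_ge z.im
  have a4 := A.τ_le z.im
  have hl := A.l_pos
  have hl1 := A.l_lt
  have hpos : 0 < σ z.re - τ z.im := by
    rw [A.mem_lattice_iff] at hz
    exact lt_of_le_of_ne (by linarith) fun h ↦ hz (by linarith)
  have n1 : ‖(-1 / 3 : ℂ) + ((σ z.re : ℂ) + τ z.im) / 2‖ ≤ 4 / 3 := by
    have : (-1 / 3 : ℂ) + ((σ z.re : ℂ) + τ z.im) / 2 =
      ((-1 / 3 + (σ z.re + τ z.im) / 2 : ℝ) : ℂ) := by push_cast; ring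
    rw [this, Complex.norm_real, Real.norm_eq_abs, abs_le]
    constructor <;> linarith
  have n2 : ‖(σ₁ z.re : ℂ) + Complex.I * τ₁ z.im‖ ^ 2 ≤ 6 * (σ z.re - τ z.im) := by
    rw [mul_comm Complex.I, Complex.sq_norm, Complex.normSq_add_mul_I, A.σ_sq, A.τ_sq]
    have e : 2 * (1 - σ z.re) * (σ z.re ^ 2 - l ^ 2) + 2 * (1 - τ z.im) * (l ^ 2 - τ z.im ^ 2) =
      (2 * (σ z.re + τ z.im - (σ z.re ^ 2 + σ z.re * τ z.im + τ z.im ^ 2) + l ^ 2)) *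
        (σ z.re - τ z.im) := by ring
    rw [e]
    gcongr
    nlinarith [sq_nonneg (σ z.re + τ z.im), sq_nonneg (σ z.re), sq_nonneg (τ z.im)]
  have n3 : ‖(1 / 4 : ℂ) * (((σ₁ z.re : ℂ) + Complex.I * τ₁ z.im) /
      ((σ z.re : ℂ) - τ z.im)) ^ 2‖ ≤ 3 / 2 / (σ z.re - τ z.im) := by
    have : ‖(1 / 4 : ℂ)‖ = 1 / 4 := by norm_num
    rw [norm_mul, this, norm_pow, norm_div, div_pow, ← Complex.ofReal_sub, Complex.norm_real,
      Real.norm_of_nonneg hpos.le, le_div_iff₀ hpos]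
    calc _ = ‖(σ₁ z.re : ℂ) + Complex.I * τ₁ z.im‖ ^ 2 / (4 * (σ z.re - τ z.im)) := by
            field_simp
      _ ≤ 3 / 2 := by rw [div_le_iff₀ (by positivity)]; linarith
  exact (norm_add_le _ _).trans (add_le_add n1 n3)

lemma l_mul_pos : 0 < l * (1 - l) := mul_pos A.l_pos (by linarith [A.l_lt])

/-- As `σ'' = 2l(1 - l) = -τ''` at `0`, the difference `σ - τ` is at least `l(1 - l)/2 · |z|²` near
`0`. The resulting bound makes the singularity of `z² · addition` removable. -/
lemma eventually_norm_sq_mul_addition_le : ∃ C, ∀ᶠ z : ℂ in 𝓝 0, z ∉ A.periodPair.lattice →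
    ‖z ^ 2 * addition σ σ₁ τ τ₁ z‖ ≤ C := by
  have hq := A.l_mul_pos
  have h1 := eventually_mul_sq_le (g := fun x ↦ σ x - l) (fun x ↦ (A.σ_deriv x).sub_const l)
    (A.σ₁_deriv 0) (by simp [A.σ_zero]) A.σ₁_zero
    (by rw [A.σ_zero]; linarith)
  have h2 := eventually_mul_sq_le (g := fun x ↦ l - τ x) (fun x ↦ (A.τ_deriv x).const_sub l)
    (A.τ₁_deriv 0).neg (by simp [A.τ_zero]) (by simp [A.τ₁_zero])
    (by rw [A.τ_zero]; linarith)
  rw [A.σ_zero] at h1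
  rw [A.τ_zero] at h2
  have hre : Tendsto Complex.re (𝓝 0) (𝓝 0) := Complex.continuous_re.tendsto 0
  have him : Tendsto Complex.im (𝓝 0) (𝓝 0) := Complex.continuous_im.tendsto 0
  refine ⟨4 / 3 + 3 / (l * (1 - l)), ?_⟩
  filter_upwards [hre.eventually h1, him.eventually h2, Metric.ball_mem_nhds (0 : ℂ) one_pos]
    with z k1 k2 k3 hz
  have hb := A.norm_addition_le hz
  have hz1 : ‖z‖ ^ 2 ≤ 1 := by
    rw [mem_ball_zero_iff] at k3
    nlinarith [norm_nonneg z]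
  have hpos : 0 < ‖z‖ ^ 2 := by
    have : z ≠ 0 := fun h ↦ hz (h ▸ zero_mem _)
    positivity
  have hsq : ‖z‖ ^ 2 = z.re ^ 2 + z.im ^ 2 := by
    rw [Complex.sq_norm, Complex.normSq_apply]; ring
  have hd : l * (1 - l) / 2 * ‖z‖ ^ 2 ≤ σ z.re - τ z.im := by
    rw [hsq]
    linarith
  rw [norm_mul, norm_pow]
  calc _ ≤ ‖z‖ ^ 2 * (4 / 3 + 3 / 2 / (l * (1 - l) / 2 * ‖z‖ ^ 2)) := by
        refine mul_le_mul_of_nonneg_left (hb.trans ?_) hpos.le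
        gcongr
    _ = ‖z‖ ^ 2 * (4 / 3) + 3 / (l * (1 - l)) := by
        generalize l * (1 - l) = K at hq
        generalize ‖z‖ ^ 2 = r at hpos
        field_simp
    _ ≤ _ := by
        generalize 3 / (l * (1 - l)) = K
        linarith

/-- On the real axis the addition theorem degenerates. -/
lemma addition_ofReal (x : ℝ) (hx : σ x ≠ l) : addition σ σ₁ τ τ₁ x =
    ((1 / 6 - l / 2 + l * (1 - l) / (σ x - l) : ℝ) : ℂ) := by
  have hne : σ x - l ≠ 0 := sub_ne_zero.2 hx
  have : 1 / 4 * (σ₁ x / (σ x - l)) ^ 2 = 1 / 2 * (1 - σ x) * (σ x + l) / (σ x - l) := by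
    rw [div_pow, A.σ_sq]; field_simp; ring
  have e : addition σ σ₁ τ τ₁ x =
      ((-1 / 3 + (σ x + l) / 2 + 1 / 4 * (σ₁ x / (σ x - l)) ^ 2 : ℝ) : ℂ) := by
    simp [addition, A.τ_zero, A.τ₁_zero]
  rw [e, this]
  congr 1
  field_simp
  ring

/-- The values of the Weierstrass function on the horizontal line half a period above. -/
lemma addition_ofReal_add {v : ℝ} (hv : τ v = -l) (x : ℝ) :
    addition σ σ₁ τ τ₁ (x + v * Complex.I) = ((1 / 6 + l / 2 - l * (1 + l) / (σ x + l) : ℝ) : ℂ) := by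
  have h0 : τ₁ v = 0 := by
    have := A.τ_sq v
    rw [hv, neg_sq, sub_self, mul_zero] at this
    simpa using this
  have hne : σ x + l ≠ 0 := by linarith [A.σ_ge x, A.l_pos]
  have : 1 / 4 * (σ₁ x / (σ x + l)) ^ 2 = 1 / 2 * (1 - σ x) * (σ x - l) / (σ x + l) := by
    rw [div_pow, A.σ_sq]; field_simp; ring
  have e : addition σ σ₁ τ τ₁ (x + v * Complex.I) =
      ((-1 / 3 + (σ x - l) / 2 + 1 / 4 * (σ₁ x / (σ x + l)) ^ 2 : ℝ) : ℂ) := by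
    simp [addition, hv, h0, sub_eq_add_neg]
  rw [e, this]
  congr 1
  field_simp
  ring

lemma eventually_σ_ne : ∀ᶠ x in 𝓝[≠] 0, σ x ≠ l := by
  have h1 := (tendsto_div_sq_of_hasDerivAt (g := fun x ↦ σ x - l)
    (fun x ↦ (A.σ_deriv x).sub_const l) (A.σ₁_deriv 0) (by simp [A.σ_zero])
    A.σ₁_zero).eventually (eventually_ne_nhds (b := 0)
      (by rw [A.σ_zero]; nlinarith [A.l_mul_pos]))
  filter_upwards [h1] with x hx h
  simp [h] at hx

lemma tendsto_sq_mul_addition_ofReal :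
    Tendsto (fun x : ℝ ↦ (x : ℂ) ^ 2 * addition σ σ₁ τ τ₁ x) (𝓝[≠] 0) (𝓝 1) := by
  have hq := A.l_mul_pos
  have h1 := (tendsto_div_sq_of_hasDerivAt (g := fun x ↦ σ x - l)
    (fun x ↦ (A.σ_deriv x).sub_const l) (A.σ₁_deriv 0) (by simp [A.σ_zero])
    A.σ₁_zero)
  have h2 : Tendsto (fun x : ℝ ↦ x ^ 2) (𝓝[≠] 0) (𝓝 (0 ^ 2)) :=
    ((continuous_pow 2).tendsto 0).mono_left nhdsWithin_le_nhds
  have h3 := ((h2.mul_const (1 / 6 - l / 2)).add ((h1.inv₀ (by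
    rw [A.σ_zero]; nlinarith)).const_mul (l * (1 - l))))
  have h4 := (Complex.continuous_ofReal.tendsto _).comp h3
  have e : ((0 : ℝ) ^ 2 * (1 / 6 - l / 2) + l * (1 - l) *
      ((-3 * σ 0 ^ 2 + 2 * σ 0 + l ^ 2) / 2)⁻¹ : ℝ) = 1 := by
    rw [A.σ_zero, show (-3 * l ^ 2 + 2 * l + l ^ 2) / 2 = l * (1 - l) by ring,
      mul_inv_cancel₀ hq.ne']
    ring
  rw [e, Complex.ofReal_one] at h4
  refine h4.congr' ?_
  filter_upwards [A.eventually_σ_ne, self_mem_nhdsWithin] with x hx hx0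
  rw [A.addition_ofReal x hx, Function.comp_apply, ← Complex.ofReal_pow, ← Complex.ofReal_mul]
  congr 1
  have : σ x - l ≠ 0 := sub_ne_zero.2 hx
  have : x ≠ 0 := hx0
  field_simp

end AxisFunctions

end SignatureFour
end

/-! ### Identification of the addition formula with the Weierstrass function. -/

noncomputable section
namespace SignatureFour

open Real Filter Topology

/-- A quadratic polynomial in `b + m / t` that vanishes for arbitrarily small `t` is zero. -/
lemma coeff_eq_zero_of_frequently {a₂ a₁ a₀ b m : ℂ} (hm : m ≠ 0) {F : Filter ℝ} [F.NeBot]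
    {t : ℝ → ℂ} (ht : Tendsto t F (𝓝 0)) (ht0 : ∀ᶠ x in F, t x ≠ 0)
    (h : ∀ᶠ x in F, a₂ * (b + m / t x) ^ 2 + a₁ * (b + m / t x) + a₀ = 0) :
    a₂ = 0 ∧ a₁ = 0 ∧ a₀ = 0 := by
  have hlim {g : ℂ → ℂ} (hg : Continuous g) (h : ∀ᶠ x in F, g (t x) = 0) : g 0 = 0 :=
    tendsto_nhds_unique ((hg.tendsto 0).comp ht)
      (tendsto_const_nhds.congr' (h.mono fun x hx ↦ hx.symm))
  have h2 : a₂ = 0 := by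
    have := hlim (g := fun t ↦ a₂ * (b * t + m) ^ 2 + a₁ * (b * t + m) * t + a₀ * t ^ 2)
      (by fun_prop) (by
        filter_upwards [h, ht0] with x hx hx0
        have : b * t x + m = (b + m / t x) * t x := by field_simp
        rw [this]
        linear_combination (t x) ^ 2 * hx)
    simpa [hm] using this
  have h1 : a₁ = 0 := by
    have := hlim (g := fun t ↦ a₁ * (b * t + m) + a₀ * t)
      (by fun_prop) (by
        filter_upwards [h, ht0] with x hx hx0
        have : b * t x + m = (b + m / t x) * t x := by field_simp
        rw [this]
        rw [h2] at hx
        linear_combination (t x) * hx)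
    simpa [hm] using this
  refine ⟨h2, h1, ?_⟩
  obtain ⟨x, hx⟩ := h.exists
  simpa [h1, h2] using hx

lemma eventually_notMem_lattice (L : PeriodPair) (p : ℂ) : ∀ᶠ z in 𝓝[≠] p, z ∉ L.lattice := by
  have := L.compl_lattice_sdiff_singleton_mem_nhds p
  rw [eventually_nhdsWithin_iff]
  filter_upwards [this] with z hz hz0 h
  exact hz ⟨h, hz0⟩

/-- An even analytic function vanishing at `0` is `z²` times an analytic function. -/
lemma exists_eq_sq_mul_of_even {u : ℂ → ℂ} (hu : AnalyticAt ℂ u 0) (h0 : u 0 = 0)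
    (he : ∀ z, u (-z) = u z) : ∃ v : ℂ → ℂ, AnalyticAt ℂ v 0 ∧ ∀ᶠ z in 𝓝 0, u z = z ^ 2 * v z := by
  have h : ((2 : ℕ) : ℕ∞) ≤ analyticOrderAt u 0 := by
    rw [natCast_le_analyticOrderAt_iff_iteratedDeriv_eq_zero hu]
    intro i hi
    interval_cases i
    · simpa using h0
    · have := deriv_comp_neg u 0
      rw [show (fun x ↦ u (-x)) = u from funext he, neg_zero] at this
      rw [iteratedDeriv_one]
      exact CharZero.eq_neg_self_iff.1 this
  obtain ⟨v, hv, huv⟩ := (natCast_le_analyticOrderAt hu).1 h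
  exact ⟨v, hv, by simpa using huv⟩

namespace AxisFunctions

variable {l W V : ℝ} {σ σ₁ τ τ₁ : ℝ → ℝ} (A : AxisFunctions l W V σ σ₁ τ τ₁)

include A

/-- The addition formula and the Weierstrass function have the same principal part. -/
lemma exists_analyticAt_sub_weierstrassP : ∃ v : ℂ → ℂ, AnalyticAt ℂ v 0 ∧
    ∀ᶠ z in 𝓝[≠] (0 : ℂ), addition σ σ₁ τ τ₁ z - A.periodPair.weierstrassP z = v z := by
  classical
  set f := addition σ σ₁ τ τ₁
  set L := A.periodPair
  obtain ⟨C, hC⟩ := A.eventually_norm_sq_mul_addition_le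
  have hL := L.compl_lattice_sdiff_singleton_mem_nhds 0
  have hs : {z : ℂ | (z ∉ L.lattice → ‖z ^ 2 * f z‖ ≤ C) ∧ z ∈ ((L.lattice : Set ℂ) \ {0})ᶜ}
      ∈ 𝓝 (0 : ℂ) := by
    filter_upwards [hC, hL] with z h1 h2 using ⟨h1, h2⟩
  set s := {z : ℂ | (z ∉ L.lattice → ‖z ^ 2 * f z‖ ≤ C) ∧ z ∈ ((L.lattice : Set ℂ) \ {0})ᶜ}
  have hsL : ∀ z ∈ s \ {0}, z ∉ L.lattice := fun z hz h ↦ hz.1.2 ⟨h, hz.2⟩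
  have hH := Complex.differentiableOn_update_limUnder_of_bddAbove (f := fun z ↦ z ^ 2 * f z) hs
    (fun z hz ↦ ((differentiableAt_id.pow 2).mul
      (A.differentiableAt_addition (hsL z hz))).differentiableWithinAt)
    ⟨C, by rintro _ ⟨z, hz, rfl⟩; exact hz.1.1 (hsL z hz)⟩
  set c := limUnder (𝓝[≠] (0 : ℂ)) fun z ↦ z ^ 2 * f z
  set H := Function.update (fun z ↦ z ^ 2 * f z) 0 c
  have hHa : AnalyticAt ℂ H 0 := hH.analyticAt hs
  have hHz : ∀ z ≠ 0, H z = z ^ 2 * f z := fun z hz ↦ Function.update_of_ne hz _ _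
  have hof : Tendsto (fun x : ℝ ↦ (x : ℂ)) (𝓝[≠] 0) (𝓝 0) := by
    have := Complex.continuous_ofReal.tendsto 0
    rw [Complex.ofReal_zero] at this
    exact this.mono_left nhdsWithin_le_nhds
  -- The extension is continuous at `0`, so a limit along the real axis determines its value.
  have hH0 : H 0 = 1 := by
    refine tendsto_nhds_unique (hHa.continuousAt.tendsto.comp hof)
      (A.tendsto_sq_mul_addition_ofReal.congr' ?_)
    filter_upwards [self_mem_nhdsWithin] with x hx
    have hx : x ≠ 0 := hx
    exact (hHz x (by exact_mod_cast hx)).symm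
  have hHe : ∀ z, H (-z) = H z := fun z ↦ by
    by_cases hz : z = 0
    · simp [hz]
    · rw [hHz z hz, hHz (-z) (neg_ne_zero.2 hz), neg_sq]
      congr 1
      exact A.addition_neg z
  have hPa := L.analyticAt_weierstrassPExcept 0
  have hPe : ∀ z, L.weierstrassPExcept 0 (-z) = L.weierstrassPExcept 0 z := fun z ↦ by
    rw [L.weierstrassPExcept_neg, neg_zero]
  obtain ⟨v, hv, huv⟩ := exists_eq_sq_mul_of_even
    (u := fun z ↦ H z - 1 - z ^ 2 * L.weierstrassPExcept 0 z) (by fun_prop) (by simp [hH0])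
    (fun z ↦ by simp [hHe, hPe])
  refine ⟨v, hv, ?_⟩
  filter_upwards [huv.filter_mono nhdsWithin_le_nhds, self_mem_nhdsWithin] with z hz hz0
  have hz0 : z ≠ 0 := hz0
  have hP := L.weierstrassPExcept_add 0 z
  simp only [ZeroMemClass.coe_zero, sub_zero, zero_pow two_ne_zero, div_zero] at hP
  rw [← hP]
  rw [hHz z hz0] at hz
  have : z ^ 2 ≠ 0 := pow_ne_zero 2 hz0
  apply mul_left_cancel₀ this
  rw [← hz]
  field_simp
  ring

/-- Liouville: the difference extends over the lattice to an entire doubly periodic, hence bounded,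
function. -/
lemma exists_addition_eq_add_const : ∃ c : ℂ, ∀ z ∉ A.periodPair.lattice,
    addition σ σ₁ τ τ₁ z = A.periodPair.weierstrassP z + c := by
  classical
  obtain ⟨v, hv, hfv⟩ := A.exists_analyticAt_sub_weierstrassP
  set f := addition σ σ₁ τ τ₁
  set L := A.periodPair
  let E : ℂ → ℂ := fun z ↦ if z ∈ L.lattice then v 0 else f z - L.weierstrassP z
  have hE : ∀ z w, w ∈ L.lattice → E (z + w) = E z := fun z w hw ↦ by
    have h1 : z + w ∈ L.lattice ↔ z ∈ L.lattice := L.lattice.add_mem_iff_left hw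
    simp only [E, h1]
    rw [show f (z + w) = f z from A.addition_add hw z, L.weierstrassP_add_coe z ⟨w, hw⟩]
  have hE0 : E =ᶠ[𝓝 0] v := by
    rw [eventually_nhdsWithin_iff] at hfv
    have := eventually_notMem_lattice L 0
    rw [eventually_nhdsWithin_iff] at this
    filter_upwards [hfv, this] with z h1 h2
    by_cases hz : z = 0
    · simp [E, hz]
    · exact (if_neg (h2 hz)).trans (h1 hz)
  have hd : Differentiable ℂ E := fun z ↦ by
    by_cases hz : z ∈ L.lattice
    · have h0 : DifferentiableAt ℂ E (z - z) := by
        rw [sub_self]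
        exact hv.differentiableAt.congr_of_eventuallyEq hE0
      have h1 := DifferentiableAt.comp (f := fun y ↦ y - z) z h0 (by fun_prop)
      have : E ∘ (fun y ↦ y - z) = E := funext fun y ↦ by
        rw [Function.comp_apply, sub_eq_add_neg, hE _ _ (neg_mem hz)]
      rwa [this] at h1
    · have hopen := L.isClosed_lattice.isOpen_compl.mem_nhds hz
      refine ((A.differentiableAt_addition hz).sub
        (L.differentiableOn_weierstrassP.differentiableAt hopen)).congr_of_eventuallyEq ?_
      filter_upwards [hopen] with w hw
      exact if_neg hw
  refine ⟨v 0, fun z hz ↦ ?_⟩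
  have h := hd.apply_eq_apply_of_bounded (IsZLattice.isCompact_range_of_periodic L.lattice _
    hd.continuous hE).isBounded z 0
  simp only [E, if_neg hz, zero_mem, if_true] at h
  rw [← h]
  ring

/-- The addition formula is the Weierstrass function of the rectangular lattice, whose invariants
are thereby determined. -/
theorem weierstrassP_eq_addition : A.periodPair.g₂ = 1 / 3 + l ^ 2 ∧
    A.periodPair.g₃ = -1 / 27 + l ^ 2 / 3 ∧
    ∀ z ∉ A.periodPair.lattice, A.periodPair.weierstrassP z = addition σ σ₁ τ τ₁ z := by
  obtain ⟨c, hc⟩ := A.exists_addition_eq_add_const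
  set L := A.periodPair
  have hl := A.l_mul_pos
  have hval (x : ℝ) (hx : σ x ≠ l) : L.weierstrassP x =
      ((1 / 6 - l / 2 + l * (1 - l) / (σ x - l) : ℝ) : ℂ) - c := by
    have : (x : ℂ) ∉ L.lattice := by
      rw [A.mem_lattice_iff]; simpa [A.τ_zero] using hx
    rw [← A.addition_ofReal x hx, hc x this]
    ring
  have hder (x : ℝ) (hx : σ x ≠ l) : L.derivWeierstrassP x =
      ((-(l * (1 - l) * σ₁ x) / (σ x - l) ^ 2 : ℝ) : ℂ) := by
    have hxL : (x : ℂ) ∉ L.lattice := by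
      rw [A.mem_lattice_iff]; simpa [A.τ_zero] using hx
    have hd : HasDerivAt (fun t : ℝ ↦ L.weierstrassP t) (L.derivWeierstrassP x) x := by
      rw [← L.deriv_weierstrassP]
      exact (L.differentiableOn_weierstrassP.differentiableAt
        (L.isClosed_lattice.isOpen_compl.mem_nhds hxL)).hasDerivAt.comp_ofReal
    have hne : σ x - l ≠ 0 := sub_ne_zero.2 hx
    have hd2 := (((((hasDerivAt_const x (l * (1 - l))).div ((A.σ_deriv x).sub_const l)
      hne).const_add (1 / 6 - l / 2)).ofReal_comp).sub_const c)
    have hev : (fun t : ℝ ↦ L.weierstrassP t) =ᶠ[𝓝 x] fun t : ℝ ↦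
        ((1 / 6 - l / 2 + l * (1 - l) / (σ t - l) : ℝ) : ℂ) - c := by
      filter_upwards [(A.σ_deriv x).continuousAt.eventually_ne hx] with t ht using hval t ht
    have := hd.unique (hd2.congr_of_eventuallyEq hev)
    rw [this]
    congr 1
    ring
  -- With `f = ℘ + c`, this subtracts the cubic equation of `f`, known from `σ`, from that of `℘`.
  -- The cubes cancel, leaving a quadratic in `f` with leading coefficient `12c`; as `f` has a pole
  -- at `0`, all coefficients vanish.
  have hrel (x : ℝ) (hx : σ x ≠ l) : 12 * c * ((1 / 6 - l / 2 : ℂ) + l * (1 - l) / (σ x - l)) ^ 2 +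
      (L.g₂ - (1 / 3 + l ^ 2) - 12 * c ^ 2) * ((1 / 6 - l / 2 : ℂ) + l * (1 - l) / (σ x - l)) +
      (4 * c ^ 3 - L.g₂ * c + L.g₃ - (-1 / 27 + l ^ 2 / 3)) = 0 := by
    have hxL : (x : ℂ) ∉ L.lattice := by
      rw [A.mem_lattice_iff]; simpa [A.τ_zero] using hx
    have h := L.derivWeierstrassP_sq x hxL
    rw [hval x hx, hder x hx, ← Complex.ofReal_pow] at h
    have hne : σ x - l ≠ 0 := sub_ne_zero.2 hx
    have e : (-(l * (1 - l) * σ₁ x) / (σ x - l) ^ 2) ^ 2 =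
        4 * (1 / 6 - l / 2 + l * (1 - l) / (σ x - l)) ^ 3 -
        (1 / 3 + l ^ 2) * (1 / 6 - l / 2 + l * (1 - l) / (σ x - l)) - (-1 / 27 + l ^ 2 / 3) := by
      rw [div_pow, neg_sq, mul_pow, A.σ_sq]
      field_simp
      ring
    rw [e] at h
    push_cast at h
    linear_combination h
  have hne := A.eventually_σ_ne
  have ht : Tendsto (fun x : ℝ ↦ (σ x : ℂ) - l) (𝓝[≠] 0) (𝓝 0) := by
    have h1 : Tendsto (fun x : ℝ ↦ (σ x : ℂ) - l) (𝓝 0) (𝓝 ((σ 0 : ℂ) - l)) :=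
      ((Complex.continuous_ofReal.tendsto _).comp (A.σ_deriv 0).continuousAt.tendsto).sub_const _
    rw [A.σ_zero, sub_self] at h1
    exact h1.mono_left nhdsWithin_le_nhds
  obtain ⟨h2, h1, h0⟩ := coeff_eq_zero_of_frequently (m := l * (1 - l))
    (by exact_mod_cast hl.ne') ht
    (hne.mono fun x hx ↦ sub_ne_zero.2 (by exact_mod_cast hx)) (hne.mono hrel)
  have hc0 : c = 0 := by simpa using h2
  subst hc0
  refine ⟨by linear_combination h1, by linear_combination h0, fun z hz ↦ ?_⟩
  rw [hc z hz, add_zero]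

end AxisFunctions

end SignatureFour
end

/-! ### Weierstrass functions: dependence on the invariants, periods, and translates. -/

noncomputable section
namespace SignatureFour

open Filter Topology

/-- Two meromorphic functions in normal form on the plane that agree frequently near a point are
equal. -/
lemma eq_of_frequently_eq {f g : ℂ → ℂ} (hf : MeromorphicNFOn f univ)
    (hg : MeromorphicNFOn g univ) {z₀ : ℂ} (h : ∃ᶠ z in 𝓝[≠] z₀, f z = g z) : f = g := by
  have hm : MeromorphicOn (f - g) univ := fun z hz ↦
    (hf hz).meromorphicAt.sub (hg hz).meromorphicAt
  have h0 : meromorphicOrderAt (f - g) z₀ = ⊤ := by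
    rw [meromorphicOrderAt_eq_top_iff]
    have := (MeromorphicAt.frequently_eq_iff_eventuallyEq (hf (mem_univ z₀)).meromorphicAt
      (hg (mem_univ z₀)).meromorphicAt).1 h
    filter_upwards [this] with z hz
    simp [hz]
  funext z
  have hz : meromorphicOrderAt (f - g) z = ⊤ := by
    by_contra hne
    exact hm.meromorphicOrderAt_ne_top_of_isPreconnected isPreconnected_univ (mem_univ z)
      (mem_univ z₀) hne h0
  rw [meromorphicOrderAt_eq_top_iff] at hz
  have := (MeromorphicNFAt.eventuallyEq_nhdsNE_iff_eventuallyEq_nhds (hf (mem_univ z))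
    (hg (mem_univ z))).1 (hz.mono fun w hw ↦ sub_eq_zero.1 hw)
  exact this.eq_of_nhds

section PeriodPair

variable (L : PeriodPair)

lemma tendsto_weierstrassP_cobounded {p : ℂ} (hp : p ∈ L.lattice) :
    Tendsto L.weierstrassP (𝓝[≠] p) (Bornology.cobounded ℂ) :=
  tendsto_cobounded_of_meromorphicOrderAt_neg (by
    rw [L.order_weierstrassP p hp]
    exact WithTop.coe_lt_coe.2 (by norm_num : (-2 : ℤ) < 0))

lemma meromorphicNFOn_weierstrassP : MeromorphicNFOn L.weierstrassP univ := fun z _ ↦ by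
  rw [meromorphicNFAt_iff_analyticAt_or]
  by_cases hz : z ∈ L.lattice
  · refine .inr ⟨L.meromorphic_weierstrassP z, ?_, L.weierstrassP_coe ⟨z, hz⟩⟩
    rw [L.order_weierstrassP z hz]
    exact WithTop.coe_lt_coe.2 (by norm_num : (-2 : ℤ) < 0)
  · exact .inl (L.analyticOnNhd_weierstrassP z hz)

/-- The difference of two Weierstrass functions with the same invariants satisfies a first order
linear equation near the origin. -/
lemma sub_weierstrassPExcept_equation {L M : PeriodPair} (h2 : L.g₂ = M.g₂) (h3 : L.g₃ = M.g₃) :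
    ∀ᶠ z in 𝓝[≠] (0 : ℂ), z * (deriv (L.weierstrassPExcept 0) z - deriv (M.weierstrassPExcept 0) z) *
      (z ^ 3 * (deriv (L.weierstrassPExcept 0) z + deriv (M.weierstrassPExcept 0) z) - 4) =
      (L.weierstrassPExcept 0 z - M.weierstrassPExcept 0 z) *
        (4 * ((z ^ 2 * L.weierstrassPExcept 0 z + 1) ^ 2 + (z ^ 2 * L.weierstrassPExcept 0 z + 1) *
          (z ^ 2 * M.weierstrassPExcept 0 z + 1) + (z ^ 2 * M.weierstrassPExcept 0 z + 1) ^ 2) -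
          M.g₂ * z ^ 4) := by
  filter_upwards [eventually_notMem_lattice L 0, eventually_notMem_lattice M 0,
    self_mem_nhdsWithin] with z hL hM hz
  have hz : z ≠ 0 := hz
  have e (N : PeriodPair) (hN : z ∉ N.lattice) :
      (deriv (N.weierstrassPExcept 0) z - 2 / z ^ 3) ^ 2 =
        4 * (N.weierstrassPExcept 0 z + 1 / z ^ 2) ^ 3 -
          N.g₂ * (N.weierstrassPExcept 0 z + 1 / z ^ 2) - N.g₃ := by
    have h := N.derivWeierstrassP_sq z hN
    have a := N.weierstrassPExcept_add 0 z
    have b := N.derivWeierstrassPExcept_def 0 z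
    have d := N.eqOn_deriv_weierstrassPExcept_derivWeierstrassPExcept 0
      (show z ∈ ((N.lattice : Set ℂ) \ {0})ᶜ from fun h ↦ hN h.1)
    simp only [ZeroMemClass.coe_zero, sub_zero, zero_pow two_ne_zero, div_zero] at a b
    rw [a, d, b, add_sub_cancel_right, h]
  have e1 := e L hL
  have e2 := e M hM
  rw [h2, h3] at e1
  generalize deriv (L.weierstrassPExcept 0) z = p' at *
  generalize deriv (M.weierstrassPExcept 0) z = q' at *
  generalize L.weierstrassPExcept 0 z = p at *
  generalize M.weierstrassPExcept 0 z = q at *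
  field_simp at e1 e2
  apply mul_left_cancel₀ (pow_ne_zero 2 hz)
  linear_combination e1 - e2

/-- A Weierstrass function is determined by its invariants. -/
theorem weierstrassP_eq_of_invariants {L M : PeriodPair} (h2 : L.g₂ = M.g₂) (h3 : L.g₃ = M.g₃) :
    L.weierstrassP = M.weierstrassP := by
  set p := L.weierstrassPExcept 0
  set q := M.weierstrassPExcept 0
  have hp : AnalyticAt ℂ p 0 := L.analyticAt_weierstrassPExcept 0
  have hq : AnalyticAt ℂ q 0 := M.analyticAt_weierstrassPExcept 0
  have key : ∀ᶠ z in 𝓝 0, p z - q z = 0 := by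
    by_contra hne
    -- If the regular parts differ, their difference is `zⁿ g` with `g(0) ≠ 0`. Lowest-order terms
    -- of the linear equation then give `-4n g(0) = 12 g(0)`, that is `n = -3`, which is impossible.
    obtain ⟨n, g, hg, hg0, hpg⟩ :=
      ((hp.sub hq).exists_eventuallyEq_pow_smul_nonzero_iff).2 hne
    simp only [sub_zero, smul_eq_mul] at hpg
    have hder : ∀ᶠ z in 𝓝 0, z * (deriv p z - deriv q z) = z ^ n * (n * g z + z * deriv g z) := by
      filter_upwards [hpg.eventually_nhds, hp.eventually_analyticAt, hq.eventually_analyticAt,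
        hg.eventually_analyticAt] with z h hpz hqz hgz
      have h1 := (hpz.differentiableAt.hasDerivAt.sub hqz.differentiableAt.hasDerivAt)
      have h2 := (((hasDerivAt_pow n z).mul hgz.differentiableAt.hasDerivAt)).congr_of_eventuallyEq
        (f₁ := p - q) h
      rw [h1.unique h2]
      rcases n with _ | n
      · simp
      · simp only [Nat.add_one_sub_one]
        ring
    have hp' : ContinuousAt (deriv p) 0 := hp.deriv.continuousAt
    have hq' : ContinuousAt (deriv q) 0 := hq.deriv.continuousAt
    have hg' : ContinuousAt (deriv g) 0 := hg.deriv.continuousAt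
    have hpc := hp.continuousAt
    have hqc := hq.continuousAt
    have hgc := hg.continuousAt
    have hlim : (fun z ↦ (n * g z + z * deriv g z) * (z ^ 3 * (deriv p z + deriv q z) - 4)) =ᶠ[𝓝[≠] 0]
        fun z ↦ g z * (4 * ((z ^ 2 * p z + 1) ^ 2 + (z ^ 2 * p z + 1) *
          (z ^ 2 * q z + 1) + (z ^ 2 * q z + 1) ^ 2) - M.g₂ * z ^ 4) := by
      filter_upwards [sub_weierstrassPExcept_equation h2 h3, hder.filter_mono nhdsWithin_le_nhds,
        hpg.filter_mono nhdsWithin_le_nhds, self_mem_nhdsWithin] with z k1 k2 k3 hz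
      have hz : z ≠ 0 := hz
      have hzn : z ^ n ≠ 0 := pow_ne_zero n hz
      apply mul_left_cancel₀ hzn
      change z * (deriv p z - deriv q z) * (z ^ 3 * (deriv p z + deriv q z) - 4) =
        (p z - q z) * _ at k1
      change p z - q z = _ at k3
      rw [k2, k3] at k1
      linear_combination k1
    have c1 : ContinuousAt (fun z ↦ (n * g z + z * deriv g z) *
      (z ^ 3 * (deriv p z + deriv q z) - 4)) 0 := by fun_prop
    have c2 : ContinuousAt (fun z ↦ g z * (4 * ((z ^ 2 * p z + 1) ^ 2 + (z ^ 2 * p z + 1) *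
          (z ^ 2 * q z + 1) + (z ^ 2 * q z + 1) ^ 2) - M.g₂ * z ^ 4)) 0 := by fun_prop
    have := tendsto_nhds_unique_of_eventuallyEq
      (c1.tendsto.mono_left nhdsWithin_le_nhds) (c2.tendsto.mono_left nhdsWithin_le_nhds) hlim
    have h4 : ((n : ℂ) + 3) * g 0 = 0 := by
      simp at this
      linear_combination (-1 / 4) * this
    refine (mul_eq_zero.1 h4).elim (fun h ↦ ?_) hg0
    have : ((n + 3 : ℕ) : ℂ) = 0 := by exact_mod_cast h
    exact absurd (Nat.cast_eq_zero.1 this) (by omega)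
  refine eq_of_frequently_eq (meromorphicNFOn_weierstrassP L) (meromorphicNFOn_weierstrassP M)
    (z₀ := 0) (Eventually.frequently ?_)
  filter_upwards [key.filter_mono nhdsWithin_le_nhds] with z hz
  have a := L.weierstrassPExcept_add 0 z
  have b := M.weierstrassPExcept_add 0 z
  rw [← a, ← b]
  simp only [ZeroMemClass.coe_zero]
  rw [show L.weierstrassPExcept 0 z = M.weierstrassPExcept 0 z from sub_eq_zero.1 hz]

/-- The periods of a Weierstrass function are the points of its lattice. -/
theorem periodic_weierstrassP_iff {w : ℂ} : Function.Periodic L.weierstrassP w ↔ w ∈ L.lattice := by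
  refine ⟨fun h ↦ ?_, fun h z ↦ L.weierstrassP_add_coe z ⟨w, h⟩⟩
  by_contra hw
  refine L.not_continuousAt_weierstrassP 0 (zero_mem _) ?_
  have h1 : ContinuousAt L.weierstrassP (0 + w) := by
    rw [zero_add]; exact (L.analyticOnNhd_weierstrassP w hw).continuousAt
  have h2 : ContinuousAt (fun z ↦ L.weierstrassP (z + w)) 0 :=
    ContinuousAt.comp (f := fun z ↦ z + w) h1 (by fun_prop)
  rwa [show (fun z ↦ L.weierstrassP (z + w)) = L.weierstrassP from funext h] at h2

open Classical in
/-- The elliptic function `1/3 - 2 ℘(z + a)` in normal form. -/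
def shiftedP (a z : ℂ) : ℂ := if z + a ∈ L.lattice then 0 else 1 / 3 - 2 * L.weierstrassP (z + a)

variable {L}

lemma shiftedP_eventuallyEq (a z : ℂ) : (fun z ↦ 1 / 3 - 2 * L.weierstrassP (z + a)) =ᶠ[𝓝[≠] z]
    shiftedP L a := by
  have h := eventually_notMem_lattice L (z + a)
  rw [eventually_nhdsWithin_iff] at h
  rw [EventuallyEq, eventually_nhdsWithin_iff]
  have := (continuous_add_const a).tendsto z |>.eventually h
  filter_upwards [this] with w hw hwz
  exact (if_neg (hw (by simpa using hwz))).symm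

lemma analyticAt_shiftedP {a z : ℂ} (hz : z + a ∉ L.lattice) : AnalyticAt ℂ (shiftedP L a) z := by
  have h1 : AnalyticAt ℂ (fun z ↦ 1 / 3 - 2 * L.weierstrassP (z + a)) z := by
    have := (L.analyticOnNhd_weierstrassP (z + a) hz).comp_of_eq
      (f := fun z ↦ z + a) (by fun_prop) rfl
    exact analyticAt_const.sub (analyticAt_const.mul this)
  refine h1.congr ?_
  have := (continuous_add_const a).tendsto z |>.eventually
    (L.isClosed_lattice.isOpen_compl.mem_nhds hz)
  filter_upwards [this] with w hw
  exact (if_neg hw).symm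

lemma tendsto_shiftedP_cobounded {a z : ℂ} (hz : z + a ∈ L.lattice) :
    Tendsto (shiftedP L a) (𝓝[≠] z) (Bornology.cobounded ℂ) := by
  refine Tendsto.congr' (shiftedP_eventuallyEq a z) ?_
  have h1 : Tendsto (fun w ↦ L.weierstrassP (w + a)) (𝓝[≠] z) (Bornology.cobounded ℂ) :=
    (tendsto_weierstrassP_cobounded L hz).comp
      (tendsto_nhdsWithin_of_tendsto_nhds_of_eventually_within _
        (((continuous_add_const a).tendsto z).mono_left nhdsWithin_le_nhds)
        (eventually_nhdsWithin_of_forall fun w hw ↦ by simpa using hw))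
  rw [← tendsto_norm_atTop_iff_cobounded] at h1 ⊢
  -- The comparison is `‖1/3 - 2℘‖ ≥ 2‖℘‖ - 1/3 ≥ ‖℘‖ - 1`.
  refine tendsto_atTop_mono (fun w ↦ ?_) (tendsto_atTop_add_const_right _ (-1) h1)
  have := norm_sub_norm_le (2 * L.weierstrassP (w + a)) (1 / 3)
  rw [norm_sub_rev, norm_mul] at this
  norm_num at this ⊢
  linarith [norm_nonneg (L.weierstrassP (w + a))]

lemma meromorphicNFOn_shiftedP (a : ℂ) : MeromorphicNFOn (shiftedP L a) univ := fun z _ ↦ by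
  rw [meromorphicNFAt_iff_analyticAt_or]
  by_cases hz : z + a ∈ L.lattice
  · have hm : MeromorphicAt (shiftedP L a) z := by
      refine MeromorphicAt.congr ?_ (shiftedP_eventuallyEq a z)
      have : MeromorphicAt (fun w ↦ L.weierstrassP (w + a)) z :=
        (L.meromorphic_weierstrassP (z + a)).comp_analyticAt (f := L.weierstrassP)
          (g := fun w ↦ w + a) (by fun_prop)
      exact (MeromorphicAt.const _ _).sub ((MeromorphicAt.const _ _).mul this)
    exact .inr ⟨hm, (tendsto_cobounded_iff_meromorphicOrderAt_neg hm).1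
      (tendsto_shiftedP_cobounded hz), if_pos hz⟩
  · exact .inl (analyticAt_shiftedP hz)

/-- A period outside the lattice would carry the pole at `-a` to a point of analyticity. -/
theorem periodic_shiftedP_iff {a w : ℂ} :
    Function.Periodic (shiftedP L a) w ↔ w ∈ L.lattice := by
  constructor
  · intro h
    by_contra hw
    have h1 : ContinuousAt (shiftedP L a) (-a + w) :=
      (analyticAt_shiftedP (by simpa using hw)).continuousAt
    have h2 : ContinuousAt (fun z ↦ shiftedP L a (z + w)) (-a) :=
      ContinuousAt.comp (f := fun z ↦ z + w) h1 (by fun_prop)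
    rw [show (fun z ↦ shiftedP L a (z + w)) = shiftedP L a from funext h] at h2
    have h3 := tendsto_shiftedP_cobounded (L := L) (a := a) (z := -a) (by simp)
    exact not_tendsto_nhds_of_tendsto_atTop (tendsto_norm_atTop_iff_cobounded.2 h3) _
      (h2.tendsto.mono_left nhdsWithin_le_nhds).norm
  · intro hw z
    have h1 : z + w + a ∈ L.lattice ↔ z + a ∈ L.lattice := by
      rw [add_right_comm]; exact L.lattice.add_mem_iff_left hw
    have h2 : L.weierstrassP (z + w + a) = L.weierstrassP (z + a) := by
      rw [add_right_comm]; exact L.weierstrassP_add_coe _ ⟨w, hw⟩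
    by_cases h : z + a ∈ L.lattice
    · rw [shiftedP, shiftedP, if_pos h, if_pos (h1.2 h)]
    · rw [shiftedP, shiftedP, if_neg h, if_neg (h1.not.2 h), h2]

end PeriodPair

end SignatureFour
end

/-! ### Fundamental half periods and the elliptic extension of `ρ`. -/

noncomputable section
namespace SignatureFour

open Filter Topology

/-- Positive generators of the same infinite cyclic group of reals coincide. -/
lemma int_eq_one_of_mul_eq {m m' : ℤ} {x y : ℝ} (hx : 0 < x) (hy : 0 < y) (h : m * x = y)
    (h' : m' * y = x) : y = x := by
  have h1 : (m' * m : ℤ) = 1 := by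
    have : ((m' * m : ℤ) : ℝ) * x = 1 * x := by push_cast; rw [mul_assoc, h, h', one_mul]
    exact_mod_cast mul_right_cancel₀ hx.ne' this
  have hm : 0 < m := by
    have : (0 : ℝ) < m := by
      by_contra hneg
      nlinarith
    exact_mod_cast this
  rcases Int.isUnit_iff.1 (IsUnit.of_mul_eq_one_right _ h1) with h2 | h2
  · rw [← h, h2]; simp
  · omega

/-- The positive fundamental pair of half periods of a rectangular lattice is unique. -/
lemma areFundamentalHalfPeriods_iff {f : ℂ → ℂ} {W V : ℝ} (hW : 0 < W) (hV : 0 < V)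
    (hf : ∀ w, Function.Periodic f w ↔ ∃ m n : ℤ, (m : ℂ) * W + n * (V * Complex.I) = w)
    (ω ω' : ℂ) : AreFundamentalHalfPeriods f ω ω' ↔ ω = W / 2 ∧ ω' = Complex.I * (V / 2) := by
  constructor
  · rintro ⟨⟨h1, h2⟩, ⟨h3, h4⟩, hp⟩
    simp at h3 h4
    -- Each pair generates the other. Real parts make `2ω` and `W` integer multiples of each other,
    -- and imaginary parts do the same for the other two periods.
    obtain ⟨m, n, hmn⟩ := (hf (2 * ω)).1 ((hp _).2 ⟨1, 0, by simp⟩)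
    obtain ⟨m', n', hmn'⟩ := (hp W).1 ((hf W).2 ⟨1, 0, by simp⟩)
    obtain ⟨j, k, hjk⟩ := (hf (2 * ω')).1 ((hp _).2 ⟨0, 1, by simp⟩)
    obtain ⟨j', k', hjk'⟩ := (hp (V * Complex.I)).1 ((hf _).2 ⟨0, 1, by simp⟩)
    have e1 := congrArg Complex.re hmn
    have e2 := congrArg Complex.re hmn'
    have e3 := congrArg Complex.im hjk
    have e4 := congrArg Complex.im hjk'
    simp [h1, h3] at e1 e2 e3 e4
    have r1 := int_eq_one_of_mul_eq hW (by linarith) e1 e2.symm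
    have r2 := int_eq_one_of_mul_eq hV (by linarith) e3 e4.symm
    constructor
    · apply Complex.ext
      · simp; linarith
      · simp [h1]
    · apply Complex.ext
      · simp [h3]
      · simp; linarith
  · rintro ⟨rfl, rfl⟩
    refine ⟨by simpa using hW, by simpa using hV, fun w ↦ (hf w).trans ?_⟩
    refine exists₂_congr fun m n ↦ ?_
    rw [eq_comm]
    have : (m : ℂ) * (2 * (W / 2)) + n * (2 * (Complex.I * (V / 2))) =
      m * W + n * (V * Complex.I) := by ring
    rw [this]

/-- The real axis accumulates at `0`, and the normal form excludes differing values at isolated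
points. -/
lemma IsDnTwo.unique {κ : ℝ} {d e : ℂ → ℂ} (hd : IsDnTwo κ d) (he : IsDnTwo κ e) : d = e := by
  refine eq_of_frequently_eq hd.elliptic.meromorphicNF he.elliptic.meromorphicNF (z₀ := 0) ?_
  have ht : Tendsto (fun x : ℝ ↦ (x : ℂ)) (𝓝[≠] 0) (𝓝[≠] 0) :=
    tendsto_nhdsWithin_of_tendsto_nhds_of_eventually_within _
      ((Complex.continuous_ofReal.tendsto' 0 0 rfl).mono_left nhdsWithin_le_nhds)
      (eventually_nhdsWithin_of_forall fun x hx ↦ by simpa using hx)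
  exact ht.frequently (Eventually.frequently (.of_forall fun u ↦ by
    rw [hd.extends_rho, he.extends_rho]))

/-- At height `V/2` the pendulum has `θ = π`, so `τ = -l`; there `addition` is a Möbius function of
`σ`, and the relation between `σ` and `ρ` makes `1/3 - 2℘` equal to `ρ`. -/
lemma isDnTwo_shiftedP {κ l : ℝ} (hκ0 : 0 < κ) (hκ : κ < 1) (hl0 : 0 < l)
    (hl : l ^ 2 = 1 - κ ^ 2) : IsDnTwo κ (shiftedP (axisFunctions hκ0 hκ hl0 hl).periodPair
      ((imagPeriod l / 2 : ℝ) * Complex.I)) := by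
  have A := axisFunctions hκ0 hκ hl0 hl
  have hκ' : |κ| < 1 := by rwa [abs_of_pos hκ0]
  have hl' : |l| < 1 := by rw [abs_of_pos hl0]; exact A.l_lt
  refine ⟨⟨meromorphicNFOn_shiftedP _, A.periodPair, fun w hw ↦ periodic_shiftedP_iff.2 hw⟩,
    fun u ↦ ?_⟩
  have hv : tau l (imagPeriod l / 2) = -l := by
    rw [imagPeriod_eq hl', mul_div_cancel_left₀ _ two_ne_zero, tau_half hl']
  have hn : (u : ℂ) + (imagPeriod l / 2 : ℝ) * Complex.I ∉ A.periodPair.lattice := by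
    rw [A.mem_lattice_iff]
    simp only [Complex.add_re, Complex.add_im, Complex.ofReal_re, Complex.ofReal_im,
      Complex.re_ofReal_mul, Complex.im_ofReal_mul, Complex.I_re, Complex.I_im, mul_zero, mul_one,
      add_zero, zero_add, hv]
    linarith [A.σ_ge u]
  rw [shiftedP, if_neg hn, A.weierstrassP_eq_addition.2.2 _ hn, A.addition_ofReal_add hv]
  have hp : 0 < rho κ u + l := by linarith [rho_pos hκ' u]
  have : l * (1 + l) / (sigma κ l u + l) = (rho κ u + l) / 2 := by
    rw [sigma, neg_add_cancel_comm]
    field_simp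
  rw [this]
  push_cast
  ring

end SignatureFour

end

/-! ### The main theorem. -/

theorem theorem7 (κ : ℝ) (hκ : κ ∈ Set.Ioo (0 : ℝ) 1) :
    (∃! d : ℂ → ℂ, SignatureFour.IsDnTwo κ d) ∧
    (∃! p : ℂ → ℂ, SignatureFour.IsPKappa κ p) ∧
    ∀ f : ℂ → ℂ, (SignatureFour.IsDnTwo κ f ∨ SignatureFour.IsPKappa κ f) → ∀ ω ω' : ℂ,
      (SignatureFour.AreFundamentalHalfPeriods f ω ω' ↔
        ω = (Real.pi : ℂ) / 2 * (SignatureFour.completeF (κ ^ 2) : ℂ) ∧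
        ω' = Complex.I * ((Real.sqrt 2 : ℂ) / 2) * (Real.pi : ℂ) *
          (SignatureFour.completeF (1 - κ ^ 2) : ℂ)) ∧
      (SignatureFour.AreFundamentalHalfPeriods f ω ω' →
        ω' / ω = Complex.I * (Real.sqrt 2 : ℂ) *
          ((SignatureFour.completeF (1 - κ ^ 2) : ℂ) / (SignatureFour.completeF (κ ^ 2) : ℂ))) := by
  open SignatureFour in
  obtain ⟨hκ0, hκ1⟩ := hκ
  have hpos : 0 < 1 - κ ^ 2 := by nlinarith
  obtain ⟨l, hl0, hl⟩ : ∃ l : ℝ, 0 < l ∧ l ^ 2 = 1 - κ ^ 2 :=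
    ⟨√(1 - κ ^ 2), Real.sqrt_pos.2 hpos, Real.sq_sqrt hpos.le⟩
  have A := axisFunctions hκ0 hκ1 hl0 hl
  have hκ' : |κ| < 1 := by rwa [abs_of_pos hκ0]
  have hl' : |l| < 1 := by rw [abs_of_pos hl0]; exact A.l_lt
  have hdn := isDnTwo_shiftedP hκ0 hκ1 hl0 hl
  obtain ⟨hg2, hg3, -⟩ := A.weierstrassP_eq_addition
  have hlc : (l : ℂ) ^ 2 = 1 - (κ : ℂ) ^ 2 := by exact_mod_cast hl
  have hp : IsPKappa κ A.periodPair.weierstrassP :=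
    ⟨A.periodPair, by rw [hg2, hlc]; ring, by rw [hg3, hlc]; ring, rfl⟩
  have hpu : ∀ p, IsPKappa κ p → p = A.periodPair.weierstrassP := by
    rintro _ ⟨M, h2, h3, rfl⟩
    refine weierstrassP_eq_of_invariants ?_ ?_
    · rw [h2, hg2, hlc]; ring
    · rw [h3, hg3, hlc]; ring
  refine ⟨⟨_, hdn, fun d hd ↦ hd.unique hdn⟩, ⟨_, hp, hpu⟩, fun f hf ω ω' ↦ ?_⟩
  have hper : ∀ w, Function.Periodic f w ↔
      ∃ m n : ℤ, (m : ℂ) * realPeriod κ + n * (imagPeriod l * Complex.I) = w := by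
    intro w
    rw [← A.mem_lattice]
    rcases hf with h | h
    · rw [h.unique hdn, periodic_shiftedP_iff]
    · rw [hpu f h, periodic_weierstrassP_iff]
  have hiff := areFundamentalHalfPeriods_iff A.W_pos A.V_pos hper ω ω'
  have hW : (realPeriod κ : ℂ) / 2 = (Real.pi : ℂ) / 2 * (completeF (κ ^ 2) : ℂ) := by
    rw [realPeriod_eq hκ']; push_cast; ring
  have hV : Complex.I * ((imagPeriod l : ℂ) / 2) =
      Complex.I * ((Real.sqrt 2 : ℂ) / 2) * (Real.pi : ℂ) * (completeF (1 - κ ^ 2) : ℂ) := by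
    rw [imagPeriod_eq hl', pendulumIntegral_pi hl', hl]; push_cast; ring
  rw [hW, hV] at hiff
  refine ⟨hiff, fun h ↦ ?_⟩
  obtain ⟨rfl, rfl⟩ := hiff.1 h
  have h1 : (completeF (κ ^ 2) : ℂ) ≠ 0 := by exact_mod_cast (completeF_pos hκ').ne'
  have h2 : (Real.pi : ℂ) ≠ 0 := by exact_mod_cast Real.pi_ne_zero
  field_simp
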